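/- Consider the class of linear Schrödinger equations $\mathcal L_V:\ i\psi_t+\psi_{xx}+V(t,x)\psi=0$, where $\psi$ is a complex-valued function of the real variables $t,x$ and $V$ runs through the smooth complex-valued potentials given on open sets of $(t,x)$. An admissible transformation is a triple $(V,\tilde V,\varphi)$, where $\varphi$ is a local diffeomorphism between open subsets of the space of $(t,x,\psi)\in\mathbb R\times\mathbb R\times\mathbb C$ (lying over the domains of $V$ and $\tilde V$) that maps $\mathcal L_V$ to $\mathcal L_{\tilde V}$ (as submanifolds of the second-order jet space, on which $\varphi$ acts by prolongation, wherever the prolongation is defined); for $\tilde V=V$ these $\varphi$ form the point symmetry pseudogroup $G_V$. The equivalence pseudogroup $G^\sim$ consists of the local diffeomorphisms $\mathcal T$ of the space of $(t,x,\psi,V)$ whose components for $(t,x,\psi)$ do not depend on $V$, which are defined for all values of $V$, whose restriction $\mathcal T|_{(t,x,\psi)}$ has domain and range with convex fibres over $(t,x)$, and which map every equation of the class to an equation of the class. Let $G^{\rm lin}_V$ be the set of linear superposition transformations $\tilde t=t$, $\tilde x=x$, $\tilde\psi=\psi+\Phi(t,x)$ with $\Phi$ a smooth solution of $\mathcal L_V$.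 (Equalities of local transformations and of potentials are understood on the relevant domains, and conjugates of sets of transformations are taken within the range of the conjugating map.) Then: (A) The class is uniformly semi-normalized with respect to the family $\{G^{\rm lin}_V\}$, that is, each $G^{\rm lin}_V$ is a sub-pseudogroup of $G_V$ and 1. if $\mathcal T\in G^\sim$ and $\mathcal T|_{(t,x,\psi)}\in G^{\rm lin}_V$ for some $V$, then $\mathcal T$ is the identity on its domain; 2. $G^{\rm lin}_{\mathcal TV}=\mathcal T|_{(t,x,\psi)}\,G^{\rm lin}_V\,(\mathcal T|_{(t,x,\psi)})^{-1}$ for every $V$ and every $\mathcal T\in G^\sim$; 3. for every admissible transformation $(V,\tilde V,\varphi)$, near each point of the domain of $\varphi$ there are $\varphi^1\in G^{\rm lin}_V$, $\varphi^2\in G^{\rm lin}_{\tilde V}$ and $\mathcal T\in G^\sim$ such that $\tilde V=\mathcal TV$ and $\varphi=\varphi^2\circ\mathcal T|_{(t,x,\psi)}\circ\varphi^1$. (B) Moreover, for every admissible transformation $(V,\tilde V,\varphi)$, each point of the domain of $\varphi$ has a neighbourhood to which the restriction of $\varphi$ is of the form $\mathcal T|_{(t,x,\psi)}\circ\varphi^1$,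 where $\varphi^1\colon\psi\mapsto\psi+\Phi$ belongs to $G^{\rm lin}_V$ and $\mathcal T\in G^\sim$ satisfies $\tilde V=\mathcal TV$; and this restriction carries $G^{\rm lin}_V$ onto $G^{\rm lin}_{\tilde V}$: $\varphi\,G^{\rm lin}_V\,\varphi^{-1}=G^{\rm lin}_{\tilde V}$. If the domain and the range of $\varphi$ have convex fibres over the points $(t,x)$, then both statements hold for $\varphi$ on its whole domain. -/

import Mathlib

open scoped ContDiff Topology

namespace LinSch

/-- The space of the variables `((t, x), ψ)`; the coordinate `ψ*` is the complex conjugate of `ψ`. -/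
abbrev Space : Type := (ℝ × ℝ) × ℂ

/-- Local transformations of the space of the variables: homeomorphisms between open subsets. -/
abbrev LocalTransf : Type := OpenPartialHomeomorph Space Space

/-- A smooth complex-valued potential `V(t, x)`, given on an open set of `(t, x)`. -/
structure Potential where
  dom : Set (ℝ × ℝ)
  isOpen_dom : IsOpen dom
  val : ℝ × ℝ → ℂ
  smooth : ContDiffOn ℝ ∞ val dom

/-- The function `u` satisfies `i u_t + u_xx + V u = 0` at the point `p = (t, x)`. -/
def SolvesAt (V : Potential) (u : ℝ × ℝ → ℂ) (p : ℝ × ℝ) : Prop :=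
  Complex.I * deriv (fun t : ℝ => u (t, p.2)) p.1
    + deriv (deriv (fun x : ℝ => u (p.1, x))) p.2 + V.val p * u p = 0

/-- The part of the space of the variables that lies over a set of points `(t, x)`. -/
def above (B : Set (ℝ × ℝ)) : Set Space := {z | z.1 ∈ B}

theorem isOpen_above {B : Set (ℝ × ℝ)} (hB : IsOpen B) : IsOpen (above B) :=
  hB.preimage continuous_fst

/-- Smoothness of a local homeomorphism in both directions: a local diffeomorphism. -/
def IsSmooth {E : Type*} [NormedAddCommGroup E] [NormedSpace ℝ E]
    (φ : OpenPartialHomeomorph E E) : Prop :=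
  ContDiffOn ℝ ∞ φ φ.source ∧ ContDiffOn ℝ ∞ φ.symm φ.target

/-- `φ` maps the graph of `u` near the point over `p` into the graph of `u'`,
and sends the point over `p` to the point over `p'`. -/
def MapsGraphAt (φ : LocalTransf) (u u' : ℝ × ℝ → ℂ) (p p' : ℝ × ℝ) : Prop :=
  (p, u p) ∈ φ.source ∧ (φ (p, u p)).1 = p' ∧
    ∀ᶠ q in 𝓝 p, u' (φ (q, u q)).1 = (φ (q, u q)).2

/-- `(V, V', φ)` is an admissible transformation: the point transformation `φ` maps the equation
with potential `V` to the equation with potential `V'`.  As subsets of the second-order jet space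
(every jet is the jet of a function, and `φ` acts on jets through graphs of functions)
the two equations correspond to each other under `φ`. -/
def Admissible (V V' : Potential) (φ : LocalTransf) : Prop :=
  IsSmooth φ ∧ φ.source ⊆ above V.dom ∧ φ.target ⊆ above V'.dom ∧
    ∀ (u u' : ℝ × ℝ → ℂ) (p p' : ℝ × ℝ), ContDiffAt ℝ ∞ u p → ContDiffAt ℝ ∞ u' p' →
      MapsGraphAt φ u u' p p' → (SolvesAt V u p ↔ SolvesAt V' u' p')

/-- The point symmetry pseudogroup of the equation with potential `V`. -/
def symGroup (V : Potential) : Set LocalTransf := {φ | Admissible V V φ}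

/-- The linear superposition transformations `(t, x, ψ) ↦ (t, x, ψ + Φ(t, x))`,
where `Φ` is a solution of the equation with potential `V`. -/
def linGroup (V : Potential) : Set LocalTransf :=
  {ν | ν.source ⊆ above V.dom ∧ ∃ Φ : ℝ × ℝ → ℂ,
    ContDiffOn ℝ ∞ Φ (Prod.fst '' ν.source) ∧ (∀ p ∈ Prod.fst '' ν.source, SolvesAt V Φ p) ∧
    ∀ z ∈ ν.source, ν z = (z.1, z.2 + Φ z.1)}

/-- The fibres of `U` over the points `(t, x)` are convex. -/
def FibreConvex (U : Set Space) : Prop :=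
  ∀ p : ℝ × ℝ, Convex ℝ {ψ : ℂ | (p, ψ) ∈ U}

/-- A transformation of the joint space of the variables and the arbitrary element `V` whose
components for the variables do not depend on `V`; `proj` is its restriction to the space of the
variables.  It is defined for all values of `V`, and its domain and range (in the space of the
variables) have convex fibres over `(t, x)`. -/
structure ProjectableTransf where
  ext : OpenPartialHomeomorph (Space × ℂ) (Space × ℂ)
  proj : LocalTransf
  smooth : IsSmooth ext
  ext_source : ext.source = proj.source ×ˢ Set.univ
  ext_target : ext.target = proj.target ×ˢ Set.univ
  ext_fst : ∀ w ∈ ext.source, (ext w).1 = proj w.1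
  fibre_source : FibreConvex proj.source
  fibre_target : FibreConvex proj.target

/-- The restriction to the space of the variables, over the domain of the potential `V`. -/
noncomputable def ProjectableTransf.on (T : ProjectableTransf) (V : Potential) : LocalTransf :=
  T.proj.restrOpen (above V.dom) (isOpen_above V.isOpen_dom)

/-- `V' = T V` on the range of `T`: the `V`-component of `T` takes the values of `V` to those of
`V'`, and the components for the variables map the one equation to the other. -/
def ProjectableTransf.Sends (T : ProjectableTransf) (V V' : Potential) : Prop :=
  (∀ z ∈ (T.on V).source, V'.val (T.proj z).1 = (T.ext (z, V.val z.1)).2) ∧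
    Admissible V V' (T.on V)

/-- The usual equivalence pseudogroup of the class: the transformations that map every equation
of the class to an equation of the class. -/
def equivGroup : Set ProjectableTransf := {T | ∀ V : Potential, ∃ V' : Potential, T.Sends V V'}

/-- `φ N φ⁻¹ = N'` (on the range of `φ`). -/
def Conjugates (φ : LocalTransf) (N N' : Set LocalTransf) : Prop :=
  ∀ ν' : LocalTransf, (ν' ∈ N' ∧ ν'.source ⊆ φ.target ∧ ν'.target ⊆ φ.target) ↔
    ∃ ν ∈ N, ν' ≈ (φ.symm.trans ν).trans φ

/-- `N` is a sub-pseudogroup of the point symmetry pseudogroup of the equation with potential `V`. -/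
structure IsSymSubgroup (V : Potential) (N : Set LocalTransf) : Prop where
  subset : N ⊆ symGroup V
  id_mem : ∀ (U : Set Space) (hU : IsOpen U), U ⊆ above V.dom →
    OpenPartialHomeomorph.ofSet U hU ∈ N
  symm_mem : ∀ ν ∈ N, ν.symm ∈ N
  trans_mem : ∀ ν ∈ N, ∀ ν' ∈ N, ν.trans ν' ∈ N

/-- The class of linear Schrödinger equations is uniformly semi-normalized with respect to
the family `N` of symmetry subgroups. -/
structure UniformlySemiNormalized (N : Potential → Set LocalTransf) : Prop where
  isSymSubgroup : ∀ V, IsSymSubgroup V (N V)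
  /-- A nonidentity equivalence transformation does not restrict to an element of `N V`. -/
  eq_id : ∀ (V : Potential), ∀ T ∈ equivGroup, T.proj ∈ N V → ∀ w ∈ T.ext.source, T.ext w = w
  equivariant : ∀ (V V' : Potential), ∀ T ∈ equivGroup, T.Sends V V' →
    Conjugates (T.on V) (N V) (N V')
  factorization : ∀ (V V' : Potential) (φ : LocalTransf), Admissible V V' φ →
    ∀ z ∈ φ.source, ∃ (U : Set Space) (hU : IsOpen U), z ∈ U ∧ U ⊆ φ.source ∧
      ∃ ν₁ ∈ N V, ∃ ν₂ ∈ N V', ∃ T ∈ equivGroup, T.Sends V V' ∧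
        φ.restrOpen U hU ≈ (ν₁.trans T.proj).trans ν₂

end LinSch

/-!
An admissible transformation `φ` is studied pointwise, through functions `u` with prescribed
second-order jets (`testFun`) and their images `u'`, which exist by the inverse function theorem
(`exists_isImage`). Let `u₁`, `u₂` agree to a suitable order at a point and let `B` be the
derivative of `φ` transversal to the graph of `u₁'` (`transvDeriv`). Then the derivatives of
`u₂' - u₁'` are those of `u₂ - u₁`, transported by `B` (`fderiv_image_sub`,
`secondDeriv_image_sub`). Three choices of test functions determine the form of `φ`.

* If `u₂ - u₁ = (t - t₀)² / 2`, both functions solve the equation at the point or neither does, so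
  the new second `x`-derivative must not see this difference. Hence the direction `∂ₓ` along a graph
  goes to the direction `∂ₓ`: the new time depends on `t` only
  (`Admissible.fderiv_time_eq_zero`).
* If `u₂ - u₁` has the `t`-derivative `w` and the second `x`-derivative `-i w`, one gets
  `D² i B w = τ B (i w)`, where `τ` is the derivative of the new time and `D` that of the new space
  variable along the graph. Applied twice, this gives `D⁴ = τ²`, whatever the slope of the graph.
  As `D` is an affine function of the slope, it is constant: the new space variable does not depend
  on `ψ` (`Admissible.fderiv_vert`). Moreover `B (i w) = ± i B w`, so the derivative of `φ` along a
  fibre is complex linear or antilinear (`Admissible.fibreDeriv_I_mul`).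
* The second difference of functions with the slopes `w`, `0`, `-w` shows that the new dependent
  variable has a vanishing second derivative along the fibres
  (`Admissible.secondDeriv_vert_snd`).

On a domain with convex fibres these facts integrate to `φ (p, ψ) = (b p, H p * σ p ψ + K p)`, with
`σ p` the identity or the complex conjugation (`IsFibreAffine`); the fibre condition on the range
makes `b` injective. The explicit form of `b` and `H` is not needed. Adding small multiples of `u`
to a solution whose graph lies in the domain shows that the linear part `u ↦ H * σ u` relates the
homogeneous equations (`Admissible.schr_linear_iff`), and subtracting a multiple of `(x - x₀)² / 2`
from `u` upgrades this to `L_{V'} (H * σ u) = H * r * σ (L_V u)`, with `r` the square of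
the derivative of the old space variable with respect to the new one (`Admissible.schr_linear`).

So superposition transformations correspond to each other under conjugation
(`Admissible.conjugates`). The function `σ (K / H)` solves the original equation, `φ` is the
superposition with it followed by the linear part, and the linear part extends to the values of the
potentials by `v ↦ V' + r * σ (v - V)`, which is an equivalence transformation
(`exists_mem_equivGroup`, `Admissible.exists_factorization`). Finally, an equivalence
transformation `ψ ↦ ψ + Φ` preserves the equations with the constant potentials `0` and `1`, which
have only the solution `Φ = 0` in common (`eq_id_of_mem_linGroup`).
-/

namespace LinSch

/-! ### Second derivatives and the Schrödinger expression -/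

section Calculus

variable {E F G : Type*} [NormedAddCommGroup E] [NormedSpace ℝ E] [NormedAddCommGroup F]
  [NormedSpace ℝ F] [NormedAddCommGroup G] [NormedSpace ℝ G]

/-- The second derivative of `f` at `x`, as a quadratic form. -/
noncomputable def secondDeriv (f : E → F) (x v : E) : F := fderiv ℝ (fderiv ℝ f) x v v

theorem _root_.ContDiffAt.differentiableAt_fderiv {f : E → F} {x : E} (hf : ContDiffAt ℝ ∞ f x) :
    DifferentiableAt ℝ (fderiv ℝ f) x :=
  (hf.fderiv_right (m := 1) (by norm_cast)).differentiableAt (by simp)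

theorem _root_.ContDiffAt.differentiableAt_top {f : E → F} {x : E} (hf : ContDiffAt ℝ ∞ f x) :
    DifferentiableAt ℝ f x := hf.differentiableAt (by simp)

theorem _root_.ContDiffAt.eventually_differentiableAt {f : E → F} {x : E}
    (hf : ContDiffAt ℝ ∞ f x) :
    ∀ᶠ y in 𝓝 x, DifferentiableAt ℝ f y := by
  have h1 : ContDiffAt ℝ 1 f x := hf.of_le (by norm_cast)
  filter_upwards [h1.eventually (by simp)] with y hy
  exact hy.differentiableAt (by simp)

theorem secondDeriv_congr {f g : E → F} {x : E} (h : f =ᶠ[𝓝 x] g) (v : E) :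
    secondDeriv f x v = secondDeriv g x v := by
  unfold secondDeriv
  rw [h.fderiv.fderiv_eq]

theorem secondDeriv_eq_fderiv_apply {f : E → F} {x : E} (hf : ContDiffAt ℝ ∞ f x) (v : E) :
    secondDeriv f x v = fderiv ℝ (fun y => fderiv ℝ f y v) x v := by
  have h := (hf.differentiableAt_fderiv.hasFDerivAt).clm_apply (hasFDerivAt_const v x)
  rw [h.fderiv]
  simp [secondDeriv]

/-- The second-order chain rule. -/
theorem secondDeriv_comp {Ψ : F → G} {c : E → F} {x : E} (hΨ : ContDiffAt ℝ ∞ Ψ (c x))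
    (hc : ContDiffAt ℝ ∞ c x) (v : E) :
    secondDeriv (fun y => Ψ (c y)) x v =
      secondDeriv Ψ (c x) (fderiv ℝ c x v) + fderiv ℝ Ψ (c x) (secondDeriv c x v) := by
  have h1 : fderiv ℝ (fun y => Ψ (c y)) =ᶠ[𝓝 x]
      fun y => (fderiv ℝ Ψ (c y)).comp (fderiv ℝ c y) := by
    filter_upwards [hc.eventually_differentiableAt,
      hc.continuousAt.eventually hΨ.eventually_differentiableAt]
      with y hy hy'
    exact fderiv_comp y hy' hy
  have h2 : HasFDerivAt (fun y => fderiv ℝ Ψ (c y))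
      ((fderiv ℝ (fderiv ℝ Ψ) (c x)).comp (fderiv ℝ c x)) x :=
    (hΨ.differentiableAt_fderiv.hasFDerivAt).comp x hc.differentiableAt_top.hasFDerivAt
  have h3 := h2.clm_comp hc.differentiableAt_fderiv.hasFDerivAt
  unfold secondDeriv
  rw [h1.fderiv_eq, h3.fderiv]
  simp [add_comm]

theorem secondDeriv_add_const_mul {f g : E → ℂ} {x : E} (hf : ContDiffAt ℝ ∞ f x)
    (hg : ContDiffAt ℝ ∞ g x) (c : ℂ) (v : E) :
    secondDeriv (fun y => f y + c * g y) x v = secondDeriv f x v + c * secondDeriv g x v := by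
  have h1 : fderiv ℝ (fun y => f y + c * g y) =ᶠ[𝓝 x]
      fun y => fderiv ℝ f y + c • fderiv ℝ g y := by
    filter_upwards [hf.eventually_differentiableAt, hg.eventually_differentiableAt] with y hy hy'
    exact (hy.hasFDerivAt.add (hy'.hasFDerivAt.const_mul c)).fderiv
  have h2 := hf.differentiableAt_fderiv.hasFDerivAt.add
    (hg.differentiableAt_fderiv.hasFDerivAt.const_smul c)
  unfold secondDeriv
  rw [h1.fderiv_eq]
  have h3 : fderiv ℝ (fun y => fderiv ℝ f y + c • fderiv ℝ g y) x = _ := h2.fderiv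
  rw [h3]
  simp

theorem fderiv_add_const_mul {f g : E → ℂ} {x : E} (hf : ContDiffAt ℝ ∞ f x)
    (hg : ContDiffAt ℝ ∞ g x) (c : ℂ) (v : E) :
    fderiv ℝ (fun y => f y + c * g y) x v = fderiv ℝ f x v + c * fderiv ℝ g x v := by
  have h := (hf.differentiableAt_top.hasFDerivAt.add
    (hg.differentiableAt_top.hasFDerivAt.const_mul c)).fderiv
  have h' : fderiv ℝ (fun y => f y + c * g y) x = _ := h
  rw [h']; simp

theorem fderiv_graph {u : E → F} {x : E} (hu : DifferentiableAt ℝ u x) (v : E) :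
    fderiv ℝ (fun y => (y, u y)) x v = (v, fderiv ℝ u x v) := by
  have h : HasFDerivAt (fun y : E => (y, u y)) ((ContinuousLinearMap.id ℝ E).prod (fderiv ℝ u x))
    x := (hasFDerivAt_id x).prodMk hu.hasFDerivAt
  rw [h.fderiv]
  simp

theorem secondDeriv_graph {u : E → F} {x : E} (hu : ContDiffAt ℝ ∞ u x) (v : E) :
    secondDeriv (fun y => (y, u y)) x v = (0, secondDeriv u x v) := by
  have hc : ContDiffAt ℝ ∞ (fun y : E => (y, u y)) x := contDiffAt_id.prodMk hu
  rw [secondDeriv_eq_fderiv_apply hc, secondDeriv_eq_fderiv_apply hu]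
  have h1 : (fun y => fderiv ℝ (fun y : E => (y, u y)) y v) =ᶠ[𝓝 x]
      fun y => (v, fderiv ℝ u y v) := by
    filter_upwards [hu.eventually_differentiableAt] with y hy
    exact fderiv_graph hy v
  rw [h1.fderiv_eq]
  have h2 : DifferentiableAt ℝ (fun y => fderiv ℝ u y v) x :=
    (hu.differentiableAt_fderiv.clm_apply (differentiableAt_const v))
  rw [((hasFDerivAt_const v x).prodMk h2.hasFDerivAt).fderiv]
  simp

end Calculus

/-- The value at `p` of the left-hand side of the equation with potential `V`. -/
noncomputable def schr (V : Potential) (u : ℝ × ℝ → ℂ) (p : ℝ × ℝ) : ℂ :=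
  Complex.I * fderiv ℝ u p (1, 0) + secondDeriv u p (0, 1) + V.val p * u p

theorem deriv_slice_fst {u : ℝ × ℝ → ℂ} {p : ℝ × ℝ} (hu : DifferentiableAt ℝ u p) :
    deriv (fun t : ℝ => u (t, p.2)) p.1 = fderiv ℝ u p (1, 0) := by
  have h : HasDerivAt (fun t : ℝ => (t, p.2)) ((1, 0) : ℝ × ℝ) p.1 :=
    (hasDerivAt_id _).prodMk (hasDerivAt_const _ _)
  exact (hu.hasFDerivAt.comp_hasDerivAt p.1 h).deriv

theorem deriv_slice_snd {u : ℝ × ℝ → ℂ} {a x : ℝ} (hu : DifferentiableAt ℝ u (a, x)) :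
    deriv (fun x : ℝ => u (a, x)) x = fderiv ℝ u (a, x) (0, 1) := by
  have h : HasDerivAt (fun x : ℝ => (a, x)) ((0, 1) : ℝ × ℝ) x :=
    (hasDerivAt_const _ _).prodMk (hasDerivAt_id _)
  exact (hu.hasFDerivAt.comp_hasDerivAt x h).deriv

theorem solvesAt_iff {V : Potential} {u : ℝ × ℝ → ℂ} {p : ℝ × ℝ} (hu : ContDiffAt ℝ ∞ u p) :
    SolvesAt V u p ↔ schr V u p = 0 := by
  have h1 : (deriv fun x : ℝ => u (p.1, x)) =ᶠ[𝓝 p.2]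
      fun x => fderiv ℝ u (p.1, x) (0, 1) := by
    have hc : ContinuousAt (fun x : ℝ => (p.1, x)) p.2 := by fun_prop
    filter_upwards [hc.eventually hu.eventually_differentiableAt] with x hx
    exact deriv_slice_snd hx
  have h2 : DifferentiableAt ℝ (fun q => fderiv ℝ u q (0, 1)) (p.1, p.2) :=
    (hu.differentiableAt_fderiv.clm_apply (differentiableAt_const _))
  unfold SolvesAt schr
  rw [deriv_slice_fst hu.differentiableAt_top, h1.deriv_eq, deriv_slice_snd h2,
    secondDeriv_eq_fderiv_apply hu]

theorem schr_congr {V : Potential} {u v : ℝ × ℝ → ℂ} {p : ℝ × ℝ} (h : u =ᶠ[𝓝 p] v) :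
    schr V u p = schr V v p := by
  unfold schr
  rw [secondDeriv_congr h, h.fderiv_eq, h.eq_of_nhds]

theorem schr_add_const_mul {V : Potential} {u v : ℝ × ℝ → ℂ} {p : ℝ × ℝ}
    (hu : ContDiffAt ℝ ∞ u p) (hv : ContDiffAt ℝ ∞ v p) (c : ℂ) :
    schr V (fun q => u q + c * v q) p = schr V u p + c * schr V v p := by
  unfold schr
  rw [secondDeriv_add_const_mul hu hv, fderiv_add_const_mul hu hv]
  ring

/-- A polynomial with prescribed value and first derivatives at `p`, and with prescribed pure
second derivatives. -/
noncomputable def testFun (p : ℝ × ℝ) (ψ ut ux uxx utt : ℂ) (q : ℝ × ℝ) : ℂ :=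
  ψ + ((q.1 - p.1 : ℝ) : ℂ) * ut + ((q.2 - p.2 : ℝ) : ℂ) * ux
    + (((q.2 - p.2) ^ 2 / 2 : ℝ) : ℂ) * uxx + (((q.1 - p.1) ^ 2 / 2 : ℝ) : ℂ) * utt

section TestFun

variable (p : ℝ × ℝ) (ψ ut ux uxx utt : ℂ)

@[simp] theorem testFun_self : testFun p ψ ut ux uxx utt p = ψ := by simp [testFun]

theorem contDiff_testFun : ContDiff ℝ ∞ (testFun p ψ ut ux uxx utt) := by
  have h : ContDiff ℝ ∞ (fun r : ℝ => (r : ℂ)) := Complex.ofRealCLM.contDiff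
  unfold testFun
  have h1 : ContDiff ℝ ∞ (fun q : ℝ × ℝ => ((q.1 - p.1 : ℝ) : ℂ)) := h.comp (by fun_prop)
  have h2 : ContDiff ℝ ∞ (fun q : ℝ × ℝ => ((q.2 - p.2 : ℝ) : ℂ)) := h.comp (by fun_prop)
  have h3 : ContDiff ℝ ∞ (fun q : ℝ × ℝ => (((q.2 - p.2) ^ 2 / 2 : ℝ) : ℂ)) :=
    h.comp (by fun_prop)
  have h4 : ContDiff ℝ ∞ (fun q : ℝ × ℝ => (((q.1 - p.1) ^ 2 / 2 : ℝ) : ℂ)) :=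
    h.comp (by fun_prop)
  exact (((contDiff_const.add (h1.mul contDiff_const)).add (h2.mul contDiff_const)).add
    (h3.mul contDiff_const)).add (h4.mul contDiff_const)

theorem fderiv_testFun (q v : ℝ × ℝ) : fderiv ℝ (testFun p ψ ut ux uxx utt) q v =
    v.1 * (ut + ((q.1 - p.1 : ℝ) : ℂ) * utt) + v.2 * (ux + ((q.2 - p.2 : ℝ) : ℂ) * uxx) := by
  have hl : HasDerivAt (fun s : ℝ => q + s • v) v 0 := by
    simpa using ((hasDerivAt_id (0 : ℝ)).smul_const v).const_add q
  have hd : DifferentiableAt ℝ (testFun p ψ ut ux uxx utt) (q + (0 : ℝ) • v) :=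
    (contDiff_testFun p ψ ut ux uxx utt).contDiffAt.differentiableAt_top
  have h1 := (hd.hasFDerivAt.comp_hasDerivAt (0 : ℝ) hl).deriv
  simp only [zero_smul, add_zero] at h1
  rw [← h1]
  have e1 : HasDerivAt (fun s : ℝ => q.1 + s * v.1 - p.1) v.1 0 := by
    simpa using (((hasDerivAt_id (0 : ℝ)).mul_const v.1).const_add q.1).sub_const p.1
  have e2 : HasDerivAt (fun s : ℝ => q.2 + s * v.2 - p.2) v.2 0 := by
    simpa using (((hasDerivAt_id (0 : ℝ)).mul_const v.2).const_add q.2).sub_const p.2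
  have e3 := (e2.pow 2).div_const 2
  have e4 := (e1.pow 2).div_const 2
  have e := (((e1.ofReal_comp.mul_const ut).const_add ψ).add
    (e2.ofReal_comp.mul_const ux)).add (e3.ofReal_comp.mul_const uxx) |>.add
    (e4.ofReal_comp.mul_const utt)
  have h2 := e.deriv
  refine Eq.trans ?_ (h2.trans ?_)
  · rfl
  · push_cast; simp; ring

theorem secondDeriv_testFun (v : ℝ × ℝ) : secondDeriv (testFun p ψ ut ux uxx utt) p v =
    v.2 ^ 2 * uxx + v.1 ^ 2 * utt := by
  rw [secondDeriv_eq_fderiv_apply (contDiff_testFun p ψ ut ux uxx utt).contDiffAt]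
  have h : (fun y => fderiv ℝ (testFun p ψ ut ux uxx utt) y v) =
      testFun p (v.1 * ut + v.2 * ux) (v.1 * utt) (v.2 * uxx) 0 0 := by
    funext y
    rw [fderiv_testFun]
    simp only [testFun]; ring
  rw [h, fderiv_testFun]
  simp; ring

theorem schr_testFun (V : Potential) : schr V (testFun p ψ ut ux uxx utt) p =
    Complex.I * ut + uxx + V.val p * ψ := by
  unfold schr
  rw [fderiv_testFun, secondDeriv_testFun]
  simp

end TestFun

/-! ### Graphs and their images under a local diffeomorphism -/

section Components

variable {E F G : Type*} [NormedAddCommGroup E] [NormedSpace ℝ E] [NormedAddCommGroup F]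
  [NormedSpace ℝ F] [NormedAddCommGroup G] [NormedSpace ℝ G]

theorem fderiv_fst_apply {f : E → F × G} {x : E} (hf : DifferentiableAt ℝ f x) (v : E) :
    fderiv ℝ (fun y => (f y).1) x v = (fderiv ℝ f x v).1 := by
  rw [hf.hasFDerivAt.fst.fderiv]; rfl

theorem fderiv_snd_apply {f : E → F × G} {x : E} (hf : DifferentiableAt ℝ f x) (v : E) :
    fderiv ℝ (fun y => (f y).2) x v = (fderiv ℝ f x v).2 := by
  rw [hf.hasFDerivAt.snd.fderiv]; rfl

theorem secondDeriv_clm_comp {f : E → F} {x : E} (L : F →L[ℝ] G) (hf : ContDiffAt ℝ ∞ f x)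
    (v : E) : secondDeriv (fun y => L (f y)) x v = L (secondDeriv f x v) := by
  rw [secondDeriv_comp L.contDiff.contDiffAt hf]
  have h : fderiv ℝ (L : F → G) = fun _ => L := by funext y; exact L.fderiv
  simp [secondDeriv, h]

theorem secondDeriv_fst {f : E → F × G} {x : E} (hf : ContDiffAt ℝ ∞ f x) (v : E) :
    secondDeriv (fun y => (f y).1) x v = (secondDeriv f x v).1 :=
  secondDeriv_clm_comp (ContinuousLinearMap.fst ℝ F G) hf v

theorem secondDeriv_snd {f : E → F × G} {x : E} (hf : ContDiffAt ℝ ∞ f x) (v : E) :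
    secondDeriv (fun y => (f y).2) x v = (secondDeriv f x v).2 :=
  secondDeriv_clm_comp (ContinuousLinearMap.snd ℝ F G) hf v

end Components

theorem IsSmooth.symm {φ : LocalTransf} (hφ : IsSmooth φ) : IsSmooth φ.symm := ⟨hφ.2, hφ.1⟩

theorem IsSmooth.contDiffAt {φ : LocalTransf} (hφ : IsSmooth φ) {z : Space}
    (hz : z ∈ φ.source) : ContDiffAt ℝ ∞ φ z :=
  hφ.1.contDiffAt (φ.open_source.mem_nhds hz)

theorem IsSmooth.fderiv_symm_fderiv {φ : LocalTransf} (hφ : IsSmooth φ) {z : Space}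
    (hz : z ∈ φ.source) (v : Space) : fderiv ℝ φ.symm (φ z) (fderiv ℝ φ z v) = v := by
  have h1 := (hφ.symm.contDiffAt (φ.map_source hz)).differentiableAt_top.hasFDerivAt
  have h2 := h1.comp z (hφ.contDiffAt hz).differentiableAt_top.hasFDerivAt
  have h3 : (φ.symm ∘ φ) =ᶠ[𝓝 z] id := by
    filter_upwards [φ.open_source.mem_nhds hz] with y hy
    exact φ.left_inv hy
  have h4 := h3.fderiv_eq (𝕜 := ℝ)
  rw [h2.fderiv, fderiv_id] at h4
  exact DFunLike.congr_fun h4 v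

theorem IsSmooth.fderiv_fderiv_symm {φ : LocalTransf} (hφ : IsSmooth φ) {z : Space}
    (hz : z ∈ φ.source) (v : Space) : fderiv ℝ φ z (fderiv ℝ φ.symm (φ z) v) = v := by
  have h := hφ.symm.fderiv_symm_fderiv (φ.map_source hz) v
  rwa [φ.symm_symm, φ.left_inv hz] at h

theorem IsSmooth.fderiv_injective {φ : LocalTransf} (hφ : IsSmooth φ) {z : Space}
    (hz : z ∈ φ.source) {v : Space} (h : fderiv ℝ φ z v = 0) : v = 0 := by
  rw [← hφ.fderiv_symm_fderiv hz v, h, map_zero]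

/-- `u` and `u'` are smooth at `p` and at its image, and `φ` maps the graph of `u` near `p` into
the graph of `u'`. -/
structure IsImage (φ : LocalTransf) (u u' : ℝ × ℝ → ℂ) (p : ℝ × ℝ) : Prop where
  smooth : ContDiffAt ℝ ∞ u p
  smooth' : ContDiffAt ℝ ∞ u' (φ (p, u p)).1
  maps : MapsGraphAt φ u u' p (φ (p, u p)).1

theorem Admissible.schr_iff {V V' : Potential} {φ : LocalTransf} (hφ : Admissible V V' φ)
    {u u' : ℝ × ℝ → ℂ} {p : ℝ × ℝ} (h : IsImage φ u u' p) :
    schr V u p = 0 ↔ schr V' u' (φ (p, u p)).1 = 0 := by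
  rw [← solvesAt_iff h.smooth, ← solvesAt_iff h.smooth']
  exact hφ.2.2.2 u u' p _ h.smooth h.smooth' h.maps

section Graph

variable {φ : LocalTransf} {u u' : ℝ × ℝ → ℂ} {p : ℝ × ℝ}

theorem IsSmooth.contDiffAt_graph (hφ : IsSmooth φ) (hu : ContDiffAt ℝ ∞ u p)
    (hz : (p, u p) ∈ φ.source) : ContDiffAt ℝ ∞ (fun q => φ (q, u q)) p :=
  (hφ.contDiffAt hz).comp p (contDiffAt_id.prodMk hu)

theorem IsSmooth.fderiv_graph (hφ : IsSmooth φ) (hu : ContDiffAt ℝ ∞ u p)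
    (hz : (p, u p) ∈ φ.source) (v : ℝ × ℝ) :
    fderiv ℝ (fun q => φ (q, u q)) p v = fderiv ℝ φ (p, u p) (v, fderiv ℝ u p v) := by
  have h1 : DifferentiableAt ℝ (fun q : ℝ × ℝ => (q, u q)) p :=
    (contDiffAt_id.prodMk hu : ContDiffAt ℝ ∞ _ p).differentiableAt_top
  have h2 := (hφ.contDiffAt hz).differentiableAt_top.hasFDerivAt.comp p h1.hasFDerivAt
  have h3 : fderiv ℝ (fun q => φ (q, u q)) p = _ := h2.fderiv
  rw [h3, ContinuousLinearMap.comp_apply, LinSch.fderiv_graph hu.differentiableAt_top]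

theorem IsSmooth.secondDeriv_graph (hφ : IsSmooth φ) (hu : ContDiffAt ℝ ∞ u p)
    (hz : (p, u p) ∈ φ.source) (v : ℝ × ℝ) :
    secondDeriv (fun q => φ (q, u q)) p v = secondDeriv φ (p, u p) (v, fderiv ℝ u p v)
      + fderiv ℝ φ (p, u p) (0, secondDeriv u p v) := by
  rw [secondDeriv_comp (c := fun q : ℝ × ℝ => (q, u q)) (hφ.contDiffAt hz)
    (contDiffAt_id.prodMk hu), LinSch.fderiv_graph hu.differentiableAt_top,
    LinSch.secondDeriv_graph hu]

/-- If the projection of the image of the graph of `u` to the plane of `(t, x)` is an immersion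
at `p`, then this image is locally the graph of a smooth function. -/
theorem exists_isImage (hφ : IsSmooth φ) (hu : ContDiffAt ℝ ∞ u p) (hz : (p, u p) ∈ φ.source)
    (hinj : ∀ v : ℝ × ℝ, (fderiv ℝ φ (p, u p) (v, fderiv ℝ u p v)).1 = 0 → v = 0) :
    ∃ u', IsImage φ u u' p := by
  have hgr := hφ.contDiffAt_graph hu hz
  have hg : ContDiffAt ℝ ∞ (fun q => (φ (q, u q)).1) p := contDiffAt_fst.comp p hgr
  have hf : ContDiffAt ℝ ∞ (fun q => (φ (q, u q)).2) p := contDiffAt_snd.comp p hgr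
  set g : ℝ × ℝ → ℝ × ℝ := fun q => (φ (q, u q)).1 with hgdef
  have hgv : ∀ v, fderiv ℝ g p v = (fderiv ℝ φ (p, u p) (v, fderiv ℝ u p v)).1 := fun v => by
    rw [hgdef, fderiv_fst_apply hgr.differentiableAt_top, hφ.fderiv_graph hu hz]
  have hinj' : Function.Injective (fderiv ℝ g p : ℝ × ℝ →ₗ[ℝ] ℝ × ℝ) := by
    rw [injective_iff_map_eq_zero]
    intro v hv
    exact hinj v (by rw [← hgv]; exact hv)
  let L : (ℝ × ℝ) ≃L[ℝ] (ℝ × ℝ) :=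
    (LinearEquiv.ofInjectiveEndo _ hinj').toContinuousLinearEquiv
  have hL : (L : ℝ × ℝ →L[ℝ] ℝ × ℝ) = fderiv ℝ g p := by
    ext <;> rfl
  have hgL : HasFDerivAt g (L : ℝ × ℝ →L[ℝ] ℝ × ℝ) p := by
    rw [hL]; exact hg.differentiableAt_top.hasFDerivAt
  have hstr : HasStrictFDerivAt g (L : ℝ × ℝ →L[ℝ] ℝ × ℝ) p := by
    rw [hL]; exact hg.hasStrictFDerivAt (by simp)
  have hi : ContDiffAt ℝ ∞ (hg.localInverse hgL (by simp)) (g p) := hg.to_localInverse hgL (by simp)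
  have hip : hg.localInverse hgL (by simp) (g p) = p := hstr.localInverse_apply_image
  refine ⟨fun q' => (φ (hg.localInverse hgL (by simp) q', u (hg.localInverse hgL (by simp) q'))).2,
    hu, ?_, hz, rfl, ?_⟩
  · have hf' : ContDiffAt ℝ ∞ (fun q => (φ (q, u q)).2) (hg.localInverse hgL (by simp) (g p)) := by
      rw [hip]; exact hf
    exact hf'.comp (g p) hi
  · have h := hstr.eventually_left_inverse
    filter_upwards [h] with q hq
    have hq' : hg.localInverse hgL (by simp) (φ (q, u q)).1 = q := hq
    simp only [hq']

theorem IsImage.fderiv_eq (hφ : IsSmooth φ) (h : IsImage φ u u' p) (v : ℝ × ℝ) :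
    (fderiv ℝ φ (p, u p) (v, fderiv ℝ u p v)).2 =
      fderiv ℝ u' (φ (p, u p)).1 (fderiv ℝ φ (p, u p) (v, fderiv ℝ u p v)).1 := by
  have hgr := hφ.contDiffAt_graph h.smooth h.maps.1
  have hg : DifferentiableAt ℝ (fun q => (φ (q, u q)).1) p :=
    (contDiffAt_fst.comp p hgr).differentiableAt_top
  have h1 := (h.smooth'.differentiableAt_top.hasFDerivAt.comp p hg.hasFDerivAt).fderiv
  have h2 := Filter.EventuallyEq.fderiv_eq (𝕜 := ℝ) h.maps.2.2
  have h3 : fderiv ℝ (fun q => u' (φ (q, u q)).1) p = _ := h1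
  rw [h3] at h2
  have h4 := DFunLike.congr_fun h2 v
  rw [fderiv_snd_apply hgr.differentiableAt_top, hφ.fderiv_graph h.smooth h.maps.1,
    ContinuousLinearMap.comp_apply, fderiv_fst_apply hgr.differentiableAt_top,
    hφ.fderiv_graph h.smooth h.maps.1] at h4
  exact h4.symm

theorem IsImage.secondDeriv_eq (hφ : IsSmooth φ) (h : IsImage φ u u' p) (v : ℝ × ℝ) :
    (secondDeriv φ (p, u p) (v, fderiv ℝ u p v)
      + fderiv ℝ φ (p, u p) (0, secondDeriv u p v)).2 =
    secondDeriv u' (φ (p, u p)).1 (fderiv ℝ φ (p, u p) (v, fderiv ℝ u p v)).1 +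
      fderiv ℝ u' (φ (p, u p)).1 (secondDeriv φ (p, u p) (v, fderiv ℝ u p v)
      + fderiv ℝ φ (p, u p) (0, secondDeriv u p v)).1 := by
  have hgr := hφ.contDiffAt_graph h.smooth h.maps.1
  have hg : ContDiffAt ℝ ∞ (fun q => (φ (q, u q)).1) p := contDiffAt_fst.comp p hgr
  have h2 := secondDeriv_congr h.maps.2.2 v
  rw [secondDeriv_comp (c := fun q => (φ (q, u q)).1) h.smooth' hg, secondDeriv_snd hgr,
    secondDeriv_fst hgr, fderiv_fst_apply hgr.differentiableAt_top,
    hφ.fderiv_graph h.smooth h.maps.1, hφ.secondDeriv_graph h.smooth h.maps.1] at h2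
  exact h2.symm

/-- The projection of the image of a graph is an immersion if the image is a graph. -/
theorem IsImage.base_injective (hφ : IsSmooth φ) (h : IsImage φ u u' p) {v : ℝ × ℝ}
    (hv : (fderiv ℝ φ (p, u p) (v, fderiv ℝ u p v)).1 = 0) : v = 0 := by
  have h1 := h.fderiv_eq hφ v
  rw [hv, map_zero] at h1
  exact congrArg Prod.fst (hφ.fderiv_injective h.maps.1 (Prod.ext hv h1))

theorem IsImage.base_surjective (hφ : IsSmooth φ) (h : IsImage φ u u' p) (k : ℝ × ℝ) :
    ∃ v : ℝ × ℝ, (fderiv ℝ φ (p, u p) (v, fderiv ℝ u p v)).1 = k := by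
  let L : ℝ × ℝ →L[ℝ] ℝ × ℝ := (ContinuousLinearMap.fst ℝ _ _).comp
    ((fderiv ℝ φ (p, u p)).comp ((ContinuousLinearMap.id ℝ _).prod (fderiv ℝ u p)))
  have hinj : Function.Injective (L : ℝ × ℝ →ₗ[ℝ] ℝ × ℝ) := by
    rw [injective_iff_map_eq_zero]
    exact fun v hv => h.base_injective hφ hv
  exact LinearMap.injective_iff_surjective.1 hinj k

end Graph

/-- The derivative at the point `z` of the graph of `u'`, in the direction of `ψ`, of the
function `(φ ·).2 - u' ((φ ·).1)` whose zero set is the preimage of the graph of `u'`. -/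
noncomputable def transvDeriv (φ : LocalTransf) (u' : ℝ × ℝ → ℂ) (z : Space) : ℂ →L[ℝ] ℂ :=
  (ContinuousLinearMap.snd ℝ (ℝ × ℝ) ℂ - (fderiv ℝ u' (φ z).1).comp
    (ContinuousLinearMap.fst ℝ (ℝ × ℝ) ℂ)).comp
    ((fderiv ℝ φ z).comp (ContinuousLinearMap.inr ℝ (ℝ × ℝ) ℂ))

theorem transvDeriv_apply (φ : LocalTransf) (u' : ℝ × ℝ → ℂ) (z : Space) (w : ℂ) :
    transvDeriv φ u' z w = (fderiv ℝ φ z (0, w)).2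
      - fderiv ℝ u' (φ z).1 (fderiv ℝ φ z (0, w)).1 := rfl

theorem graph_vec_add (L : Space →L[ℝ] Space) (v : ℝ × ℝ) (a b : ℂ) :
    L (v, b) = L (v, a) + L (0, b - a) := by
  rw [← map_add]; simp

section Difference

variable {φ : LocalTransf} {u₁ u₂ u₁' u₂' : ℝ × ℝ → ℂ} {p : ℝ × ℝ}

theorem IsImage.transvDeriv_injective (hφ : IsSmooth φ) (h : IsImage φ u₁ u₁' p) {w : ℂ}
    (hw : transvDeriv φ u₁' (p, u₁ p) w = 0) : w = 0 := by
  obtain ⟨v, hv⟩ := h.base_surjective hφ (fderiv ℝ φ (p, u₁ p) (0, w)).1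
  have h1 := h.fderiv_eq hφ v
  rw [transvDeriv_apply, sub_eq_zero, ← hv, ← h1] at hw
  have h2 : fderiv ℝ φ (p, u₁ p) ((0, w) - (v, fderiv ℝ u₁ p v)) = 0 := by
    rw [map_sub, sub_eq_zero]
    exact Prod.ext hv.symm hw
  have h3 := hφ.fderiv_injective h.maps.1 h2
  have h4 : v = 0 := by simpa using congrArg Prod.fst h3
  have h5 := congrArg Prod.snd h3
  simpa [h4] using h5

/-- First derivatives of the difference of the images of two functions with a common value. -/
theorem fderiv_image_sub (hφ : IsSmooth φ) (h₁ : IsImage φ u₁ u₁' p) (h₂ : IsImage φ u₂ u₂' p)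
    (h0 : u₁ p = u₂ p) (v : ℝ × ℝ) :
    fderiv ℝ u₂' (φ (p, u₁ p)).1 (fderiv ℝ φ (p, u₁ p) (v, fderiv ℝ u₂ p v)).1
      - fderiv ℝ u₁' (φ (p, u₁ p)).1 (fderiv ℝ φ (p, u₁ p) (v, fderiv ℝ u₂ p v)).1 =
    transvDeriv φ u₁' (p, u₁ p) (fderiv ℝ u₂ p v - fderiv ℝ u₁ p v) := by
  have e1 := h₁.fderiv_eq hφ v
  have e2 := h₂.fderiv_eq hφ v
  rw [← h0] at e2
  rw [transvDeriv_apply, ← e2,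
    graph_vec_add (fderiv ℝ φ (p, u₁ p)) v (fderiv ℝ u₁ p v) (fderiv ℝ u₂ p v),
    Prod.fst_add, Prod.snd_add, map_add, e1]
  ring

/-- Second derivatives, in a direction `v` in which the first derivatives agree, of the
difference of the images of two functions with a common value. -/
theorem secondDeriv_image_sub (hφ : IsSmooth φ) (h₁ : IsImage φ u₁ u₁' p)
    (h₂ : IsImage φ u₂ u₂' p) (h0 : u₁ p = u₂ p) {v : ℝ × ℝ}
    (hv : fderiv ℝ u₁ p v = fderiv ℝ u₂ p v) :
    secondDeriv u₂' (φ (p, u₁ p)).1 (fderiv ℝ φ (p, u₁ p) (v, fderiv ℝ u₂ p v)).1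
      - secondDeriv u₁' (φ (p, u₁ p)).1 (fderiv ℝ φ (p, u₁ p) (v, fderiv ℝ u₂ p v)).1
      + (fderiv ℝ u₂' (φ (p, u₁ p)).1 (secondDeriv (fun q => (φ (q, u₂ q)).1) p v)
      - fderiv ℝ u₁' (φ (p, u₁ p)).1 (secondDeriv (fun q => (φ (q, u₂ q)).1) p v)) =
    transvDeriv φ u₁' (p, u₁ p) (secondDeriv u₂ p v - secondDeriv u₁ p v) := by
  have e1 := h₁.secondDeriv_eq hφ v
  have e2 := h₂.secondDeriv_eq hφ v
  rw [secondDeriv_fst (hφ.contDiffAt_graph h₂.smooth h₂.maps.1),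
    hφ.secondDeriv_graph h₂.smooth h₂.maps.1]
  rw [← h0, ← hv] at e2 ⊢
  rw [transvDeriv_apply]
  have e3 := graph_vec_add (fderiv ℝ φ (p, u₁ p)) 0 (secondDeriv u₁ p v) (secondDeriv u₂ p v)
  rw [e3] at e2 ⊢
  simp only [Prod.fst_add, Prod.snd_add, map_add] at e1 e2 ⊢
  linear_combination e1 - e2

end Difference

/-! ### The first derivatives of an admissible transformation -/

theorem fderiv_testFun_self (p : ℝ × ℝ) (ψ ut ux uxx utt : ℂ) (v : ℝ × ℝ) :
    fderiv ℝ (testFun p ψ ut ux uxx utt) p v = v.1 * ut + v.2 * ux := by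
  rw [fderiv_testFun]; simp

section FirstOrder

variable {V V' : Potential} {φ : LocalTransf} {p : ℝ × ℝ} {ψ : ℂ}

theorem exists_isImage_testFun (hφ : IsSmooth φ) (hz : (p, ψ) ∈ φ.source) (ut ux uxx utt : ℂ)
    (hinj : ∀ v : ℝ × ℝ, (fderiv ℝ φ (p, ψ) (v, v.1 * ut + v.2 * ux)).1 = 0 → v = 0) :
    ∃ u', IsImage φ (testFun p ψ ut ux uxx utt) u' p := by
  refine exists_isImage hφ (contDiff_testFun p ψ ut ux uxx utt).contDiffAt (by simpa using hz) ?_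
  intro v hv
  rw [fderiv_testFun_self, testFun_self] at hv
  exact hinj v hv

/-- Linear functionals `L.1.1`, `L.1.2` that are independent remain so on some plane
spanned by a given vector `((0, 1), w)` off the kernel of the first one, and by a vector of the
form `((1, 0), η)`. -/
theorem exists_transversal {L : Space →L[ℝ] Space} (hL : Function.Surjective L) {w : ℂ}
    (hw : (L ((0, 1), w)).1.1 ≠ 0) :
    ∃ η : ℂ, ∀ v : ℝ × ℝ, (L (v, v.1 * η + v.2 * w)).1 = 0 → v = 0 := by
  by_contra! hcon
  set e := (L ((0, 1), w)).1 with he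
  have key : ∀ η : ℂ, ∃ r : ℝ, (L ((1, 0), η)).1 = r • e := by
    intro η
    obtain ⟨v, hv, hv0⟩ := hcon η
    have hdec : ((v, v.1 * η + v.2 * w) : Space) =
        v.1 • (((1, 0), η) : Space) + v.2 • (((0, 1), w) : Space) := by
      ext <;> simp
    rw [hdec, map_add, map_smul, map_smul, Prod.fst_add, Prod.smul_fst, Prod.smul_fst] at hv
    have hv1 : v.1 ≠ 0 := by
      intro h1
      rw [h1, zero_smul, zero_add] at hv
      have h2 : v.2 = 0 := by
        by_contra h2
        have := (smul_eq_zero.1 hv).resolve_left h2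
        exact hw (by rw [he, this]; rfl)
      exact hv0 (Prod.ext h1 h2)
    refine ⟨-(v.1⁻¹ * v.2), ?_⟩
    have h3 : v.1 • (L ((1, 0), η)).1 = -(v.2 • e) := eq_neg_of_add_eq_zero_left hv
    rw [neg_smul, mul_smul, ← smul_neg, ← h3, smul_smul, inv_mul_cancel₀ hv1, one_smul]
  have key2 : ∀ X : Space, ∃ r : ℝ, (L X).1 = r • e := by
    intro X
    obtain ⟨r0, h0⟩ := key 0
    obtain ⟨r1, h1⟩ := key (X.2 - X.1.2 * w)
    have hdec : X = X.1.2 • (((0, 1), w) : Space) + (X.1.1 - 1) • (((1, 0), 0) : Space)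
        + (((1, 0), X.2 - X.1.2 * w) : Space) := by
      ext <;> simp
    refine ⟨X.1.2 + (X.1.1 - 1) * r0 + r1, ?_⟩
    rw [hdec, map_add, map_add, map_smul, map_smul, Prod.fst_add, Prod.fst_add, Prod.smul_fst,
      Prod.smul_fst, h0, h1, ← he, add_smul, add_smul, mul_smul]
    simp
  obtain ⟨X, hX⟩ := hL ((0, 1), 0)
  obtain ⟨r, hr⟩ := key2 X
  rw [hX] at hr
  have h1 : r * e.1 = 0 := by simpa using (congrArg Prod.fst hr).symm
  have h2 : r = 0 := (mul_eq_zero.1 h1).resolve_right hw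
  rw [h2, zero_smul] at hr
  simpa using congrArg Prod.snd hr

/-- The new time does not vary along the lines `t = const` of graphs: this is the only direction
that second derivatives of solutions detect. The test is the pair of functions that differ by
`(t - t₀) ^ 2 / 2`; they satisfy the equation at the point in question simultaneously. -/
theorem Admissible.fderiv_time_eq_zero (hφ : Admissible V V' φ) (hz : (p, ψ) ∈ φ.source) (w : ℂ) :
    (fderiv ℝ φ (p, ψ) ((0, 1), w)).1.1 = 0 := by
  by_contra hw
  have hs := hφ.1
  obtain ⟨η, hη⟩ := exists_transversal (fun k => ⟨_, hs.fderiv_fderiv_symm hz k⟩) hw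
  set c : ℂ := -(Complex.I * η) - V.val p * ψ with hc
  obtain ⟨u₁', h₁⟩ := exists_isImage_testFun hs hz η w c 0 hη
  obtain ⟨u₂', h₂⟩ := exists_isImage_testFun hs hz η w c 1 hη
  have s₁ := (hφ.schr_iff h₁).1 (by rw [schr_testFun, hc]; ring)
  have s₂ := (hφ.schr_iff h₂).1 (by rw [schr_testFun, hc]; ring)
  have hu : testFun p ψ η w c 0 p = testFun p ψ η w c 1 p := by simp
  have hval : u₁' (φ (p, ψ)).1 = u₂' (φ (p, ψ)).1 := by
    have m1 := h₁.maps.2.2.self_of_nhds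
    have m2 := h₂.maps.2.2.self_of_nhds
    simp only [testFun_self] at m1 m2
    rw [m1, m2]
  have hfd : ∀ k, fderiv ℝ u₂' (φ (p, ψ)).1 k = fderiv ℝ u₁' (φ (p, ψ)).1 k := by
    intro k
    obtain ⟨v, hv⟩ := h₂.base_surjective hs k
    have := fderiv_image_sub hs h₁ h₂ hu v
    simp only [testFun_self, fderiv_testFun_self] at this hv
    rw [hv, sub_self, map_zero, sub_eq_zero] at this
    exact this
  obtain ⟨v, hv⟩ := h₂.base_surjective hs (0, 1)
  have hsd := secondDeriv_image_sub hs h₁ h₂ hu (v := v) (by simp only [fderiv_testFun_self])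
  simp only [testFun_self, fderiv_testFun_self, secondDeriv_testFun] at hsd hv s₁ s₂
  rw [hv, hfd, sub_self, add_zero] at hsd
  have h0 : secondDeriv u₂' (φ (p, ψ)).1 (0, 1) - secondDeriv u₁' (φ (p, ψ)).1 (0, 1) = 0 := by
    simp only [schr] at s₁ s₂
    rw [hfd, ← hval] at s₂
    linear_combination s₂ - s₁
  rw [h0] at hsd
  have hB := h₁.transvDeriv_injective hs (by rw [testFun_self]; exact hsd.symm)
  have hv1 : v.1 = 0 := by simpa using hB
  have hdec : ((v, (v.1 : ℂ) * η + v.2 * w) : Space) = v.2 • (((0, 1), w) : Space) := by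
    ext <;> simp [hv1]
  rw [hdec, map_smul] at hv
  have h3 : v.2 * (fderiv ℝ φ (p, ψ) ((0, 1), w)).1.1 = 0 := by
    simpa using congrArg Prod.fst hv
  have hv2 : v.2 = 0 := (mul_eq_zero.1 h3).resolve_right hw
  rw [hv2] at hv
  simpa using congrArg Prod.snd hv

theorem Admissible.fderiv_time_vert (hφ : Admissible V V' φ) (hz : (p, ψ) ∈ φ.source) (w : ℂ) :
    (fderiv ℝ φ (p, ψ) (0, w)).1.1 = 0 := by
  have h : ((0, w) : Space) = (((0, 1), w) : Space) - ((0, 1), 0) := by ext <;> simp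
  rw [h, map_sub, Prod.fst_sub, Prod.fst_sub, hφ.fderiv_time_eq_zero hz,
    hφ.fderiv_time_eq_zero hz, sub_zero]

theorem Admissible.fderiv_time_ne_zero (hφ : Admissible V V' φ) (hz : (p, ψ) ∈ φ.source) (w : ℂ) :
    (fderiv ℝ φ (p, ψ) ((1, 0), w)).1.1 ≠ 0 := by
  intro h
  have hX : fderiv ℝ φ (p, ψ) (fderiv ℝ φ.symm (φ (p, ψ)) ((1, 0), 0)) = ((1, 0), 0) :=
    hφ.1.fderiv_fderiv_symm hz _
  set X := fderiv ℝ φ.symm (φ (p, ψ)) ((1, 0), 0)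
  have hdec : X = X.1.1 • (((1, 0), w) : Space) + X.1.2 • (((0, 1), 0) : Space)
      + (0, X.2 - X.1.1 * w) := by
    ext <;> simp
  rw [hdec, map_add, map_add, map_smul, map_smul] at hX
  have h2 := congrArg (fun Y : Space => Y.1.1) hX
  simp only [Prod.fst_add, Prod.smul_fst, h, hφ.fderiv_time_eq_zero hz, hφ.fderiv_time_vert hz,
    smul_zero, add_zero] at h2
  exact one_ne_zero h2.symm

/-- The new time is constant along the lines `t = const` of a graph, hence so is its second
derivative along them. -/
theorem Admissible.secondDeriv_time_eq_zero (hφ : Admissible V V' φ) {u : ℝ × ℝ → ℂ}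
    (hu : ContDiff ℝ ∞ u) (hz : (p, u p) ∈ φ.source) :
    (secondDeriv (fun q => (φ (q, u q)).1) p (0, 1)).1 = 0 := by
  have hgr := hφ.1.contDiffAt_graph hu.contDiffAt hz
  have hg : ContDiffAt ℝ ∞ (fun q => (φ (q, u q)).1) p := contDiffAt_fst.comp p hgr
  have hg1 : ContDiffAt ℝ ∞ (fun q => (φ (q, u q)).1.1) p := contDiffAt_fst.comp p hg
  rw [← secondDeriv_fst hg, secondDeriv_eq_fderiv_apply hg1]
  have h0 : (fun q => fderiv ℝ (fun q => (φ (q, u q)).1.1) q (0, 1)) =ᶠ[𝓝 p] fun _ => 0 := by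
    have hcont : ContinuousAt (fun q : ℝ × ℝ => ((q, u q) : Space)) p :=
      continuousAt_id.prodMk hu.continuous.continuousAt
    filter_upwards [hcont.preimage_mem_nhds (φ.open_source.mem_nhds hz)] with q hq
    have hgrq := hφ.1.contDiffAt_graph hu.contDiffAt hq
    have hgq : ContDiffAt ℝ ∞ (fun q => (φ (q, u q)).1) q := contDiffAt_fst.comp q hgrq
    rw [fderiv_fst_apply hgq.differentiableAt_top,
      fderiv_fst_apply hgrq.differentiableAt_top, hφ.1.fderiv_graph hu.contDiffAt hq]
    exact hφ.fderiv_time_eq_zero hq _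
  rw [h0.fderiv_eq]
  simp

/-- The derivative `τ` of the new time and the derivative `D` of the new space variable along the
line `t = const` of some graph of slope `w` satisfy `D ^ 2 * i * B η = τ * B (i * η)`, where `B` is
the transversal derivative. The test is a pair of solutions at the point whose difference has the
`t`-derivative `η` and the second `x`-derivative `-i * η`. -/
theorem Admissible.exists_transvDeriv (hφ : Admissible V V' φ) (hz : (p, ψ) ∈ φ.source) {w : ℂ}
    (hw : (fderiv ℝ φ (p, ψ) ((0, 1), w)).1.2 ≠ 0) :
    ∃ u', (∀ η, transvDeriv φ u' (p, ψ) η = 0 → η = 0) ∧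
      ∀ η : ℂ, ((fderiv ℝ φ (p, ψ) ((0, 1), w)).1.2 : ℂ) ^ 2 *
        (Complex.I * transvDeriv φ u' (p, ψ) η) =
        (fderiv ℝ φ (p, ψ) ((1, 0), 0)).1.1 * transvDeriv φ u' (p, ψ) (Complex.I * η) := by
  have hs := hφ.1
  have hinj : ∀ (η : ℂ) (v : ℝ × ℝ), (fderiv ℝ φ (p, ψ) (v, v.1 * η + v.2 * w)).1 = 0 → v = 0 := by
    intro η v hv
    have hdec : ((v, v.1 * η + v.2 * w) : Space) =
        v.1 • (((1, 0), η) : Space) + v.2 • (((0, 1), w) : Space) := by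
      ext <;> simp
    rw [hdec, map_add, map_smul, map_smul] at hv
    have h1 := congrArg Prod.fst hv
    simp only [Prod.fst_add, Prod.smul_fst, hφ.fderiv_time_eq_zero hz, smul_eq_mul,
      mul_zero, add_zero, Prod.fst_zero] at h1
    have hv1 : v.1 = 0 := (mul_eq_zero.1 h1).resolve_right (hφ.fderiv_time_ne_zero hz η)
    have h2 := congrArg Prod.snd hv
    rw [hv1] at h2
    simp only [zero_smul, zero_add, Prod.smul_fst, Prod.smul_snd, Prod.snd_zero,
      smul_eq_mul] at h2
    exact Prod.ext hv1 ((mul_eq_zero.1 h2).resolve_right hw)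
  set Δ := (fderiv ℝ φ (p, ψ) ((0, 1), w)).1.2 with hΔ
  set τ := (fderiv ℝ φ (p, ψ) ((1, 0), 0)).1.1 with hτ
  have hex : (fderiv ℝ φ (p, ψ) ((0, 1), w)).1 = Δ • ((0, 1) : ℝ × ℝ) :=
    Prod.ext (by simpa using hφ.fderiv_time_eq_zero hz w) (by simp [hΔ])
  obtain ⟨u₁', h₁⟩ := exists_isImage_testFun hs hz 0 w (-(V.val p * ψ)) 0 (hinj 0)
  refine ⟨u₁', fun η h => h₁.transvDeriv_injective hs (by rw [testFun_self]; exact h), ?_⟩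
  intro η
  obtain ⟨u₂', h₂⟩ := exists_isImage_testFun hs hz η w (-(Complex.I * η) - V.val p * ψ) 0 (hinj η)
  have s₁ := (hφ.schr_iff h₁).1 (by rw [schr_testFun]; ring)
  have s₂ := (hφ.schr_iff h₂).1 (by rw [schr_testFun]; ring)
  have hu : testFun p ψ 0 w (-(V.val p * ψ)) 0 p =
    testFun p ψ η w (-(Complex.I * η) - V.val p * ψ) 0 p := by simp
  have hval : u₁' (φ (p, ψ)).1 = u₂' (φ (p, ψ)).1 := by
    have m1 := h₁.maps.2.2.self_of_nhds
    have m2 := h₂.maps.2.2.self_of_nhds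
    simp only [testFun_self] at m1 m2
    rw [m1, m2]
  have htime := hφ.secondDeriv_time_eq_zero (contDiff_testFun p ψ η w
    (-(Complex.I * η) - V.val p * ψ) 0) h₂.maps.1
  have hx := fderiv_image_sub hs h₁ h₂ hu (0, 1)
  have ht := fderiv_image_sub hs h₁ h₂ hu (1, 0)
  have hxx := secondDeriv_image_sub hs h₁ h₂ hu (v := (0, 1)) (by simp [fderiv_testFun_self])
  simp only [testFun_self, fderiv_testFun_self, secondDeriv_testFun, Complex.ofReal_zero,
    Complex.ofReal_one, zero_mul, one_mul, zero_add, add_zero, mul_zero, sub_self, map_zero,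
    sub_zero, ne_eq, OfNat.ofNat_ne_zero, not_false_eq_true, zero_pow, one_pow]
    at hx ht hxx s₁ s₂
  set B := transvDeriv φ u₁' (p, ψ)
  set d := fderiv ℝ u₂' (φ (p, ψ)).1 - fderiv ℝ u₁' (φ (p, ψ)).1 with hd
  have hdx : d (0, 1) = 0 := by
    have h0 : d (Δ • ((0, 1) : ℝ × ℝ)) = 0 := by rw [← hex]; exact hx
    rw [map_smul] at h0
    exact (smul_eq_zero.1 h0).resolve_left hw
  have hdk : ∀ k : ℝ × ℝ, d k = k.1 * d (1, 0) := by
    intro k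
    have hk : k = k.1 • ((1, 0) : ℝ × ℝ) + k.2 • ((0, 1) : ℝ × ℝ) := by ext <;> simp
    conv_lhs => rw [hk]
    rw [map_add, map_smul, map_smul, hdx]
    simp
  have hτη : (fderiv ℝ φ (p, ψ) ((1, 0), η)).1.1 = τ := by
    have := graph_vec_add (fderiv ℝ φ (p, ψ)) (1, 0) 0 η
    rw [this, Prod.fst_add, Prod.fst_add, hφ.fderiv_time_vert hz, add_zero]
  have ht' : d (fderiv ℝ φ (p, ψ) ((1, 0), η)).1 = B η := ht
  rw [hdk, hτη] at ht'
  have hxx' : secondDeriv u₂' (φ (p, ψ)).1 (Δ • ((0, 1) : ℝ × ℝ))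
      - secondDeriv u₁' (φ (p, ψ)).1 (Δ • ((0, 1) : ℝ × ℝ))
      = B (-(Complex.I * η)) := by
    have h1 : d (secondDeriv (fun q => (φ (q, testFun p ψ η w
      (-(Complex.I * η) - V.val p * ψ) 0 q)).1) p (0, 1)) = 0 := by
      rw [hdk, htime]; simp
    rw [hd, sub_apply] at h1
    rw [h1, hex, add_zero] at hxx
    rw [hxx]; congr 1; ring
  simp only [secondDeriv, map_smul, smul_apply, map_neg,
    Complex.real_smul] at hxx'
  simp only [schr, secondDeriv] at s₁ s₂
  rw [← hval] at s₂
  have hd1 : d (1, 0) = fderiv ℝ u₂' (φ (p, ψ)).1 (1, 0) - fderiv ℝ u₁' (φ (p, ψ)).1 (1, 0) := rfl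
  have hfin : Complex.I * d (1, 0) + (fderiv ℝ (fderiv ℝ u₂') (φ (p, ψ)).1 (0, 1) (0, 1)
      - fderiv ℝ (fderiv ℝ u₁') (φ (p, ψ)).1 (0, 1) (0, 1)) = 0 := by
    rw [hd1]; linear_combination s₂ - s₁
  rw [← ht']
  linear_combination (-(τ : ℂ)) * hxx' + (Δ : ℂ) ^ 2 * τ * hfin

/-- A point of a graph with prescribed slope `w` stretches the space variable by a factor whose
fourth power does not depend on `w`. -/
theorem Admissible.stretch_pow_four (hφ : Admissible V V' φ) (hz : (p, ψ) ∈ φ.source) {w : ℂ}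
    (hw : (fderiv ℝ φ (p, ψ) ((0, 1), w)).1.2 ≠ 0) :
    (fderiv ℝ φ (p, ψ) ((0, 1), w)).1.2 ^ 4 = (fderiv ℝ φ (p, ψ) ((1, 0), 0)).1.1 ^ 2 := by
  obtain ⟨u', hinj, h⟩ := hφ.exists_transvDeriv hz hw
  have h1 := h 1
  have h2 := h Complex.I
  rw [Complex.I_mul_I, map_neg] at h2
  rw [mul_one] at h1
  have h3 : transvDeriv φ u' (p, ψ) 1 ≠ 0 := fun h0 => one_ne_zero (hinj 1 h0)
  set Δ := (fderiv ℝ φ (p, ψ) ((0, 1), w)).1.2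
  set τ := (fderiv ℝ φ (p, ψ) ((1, 0), 0)).1.1
  have h4 : ((Δ : ℂ) ^ 4 - (τ : ℂ) ^ 2) * transvDeriv φ u' (p, ψ) 1 = 0 := by
    linear_combination (-(τ : ℂ)) * h2 - (Δ : ℂ) ^ 2 * Complex.I * h1 +
      ((Δ : ℂ) ^ 4 * transvDeriv φ u' (p, ψ) 1) * Complex.I_sq
  have h5 := (mul_eq_zero.1 h4).resolve_right h3
  have h6 : ((Δ ^ 4 - τ ^ 2 : ℝ) : ℂ) = 0 := by push_cast; exact h5
  exact sub_eq_zero.1 (by exact_mod_cast h6)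

/-- The new independent variables do not depend on `ψ`, to first order. -/
theorem Admissible.fderiv_vert (hφ : Admissible V V' φ) {z : Space} (hz : z ∈ φ.source) (w : ℂ) :
    (fderiv ℝ φ z (0, w)).1 = 0 := by
  obtain ⟨p, ψ⟩ := z
  refine Prod.ext (hφ.fderiv_time_vert hz w) ?_
  by_contra hℓ
  set ℓ := (fderiv ℝ φ (p, ψ) (0, w)).1.2 with hℓdef
  have hℓ0 : ℓ ≠ 0 := hℓ
  set Δ := (fderiv ℝ φ (p, ψ) ((0, 1), 0)).1.2 with hΔ
  have hline : ∀ r : ℝ, (fderiv ℝ φ (p, ψ) ((0, 1), r • w)).1.2 = Δ + r * ℓ := by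
    intro r
    have hdec : (((0, 1), r • w) : Space) = ((0, 1), 0) + r • (((0, 0), w) : Space) := by
      ext <;> simp
    rw [hdec, map_add, map_smul]
    rfl
  -- the stretch is an affine function of the slope, hence takes the values `1` and `2`
  have key : ∀ s : ℝ, s ≠ 0 → s ^ 4 = (fderiv ℝ φ (p, ψ) ((1, 0), 0)).1.1 ^ 2 := by
    intro s hs
    have h1 := hline ((s - Δ) / ℓ)
    rw [div_mul_cancel₀ _ hℓ0, add_sub_cancel] at h1
    rw [← hφ.stretch_pow_four hz (by rw [h1]; exact hs), h1]
  have h1 := key 1 one_ne_zero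
  have h2 := key 2 two_ne_zero
  rw [← h1] at h2
  norm_num at h2

theorem Admissible.stretch_ne_zero (hφ : Admissible V V' φ) (hz : (p, ψ) ∈ φ.source) (w : ℂ) :
    (fderiv ℝ φ (p, ψ) ((0, 1), w)).1.2 ≠ 0 := by
  intro h
  have h1 : (fderiv ℝ φ (p, ψ) ((0, 1), w)).1 = 0 :=
    Prod.ext (hφ.fderiv_time_eq_zero hz w) h
  -- a vector with a vertical image is vertical
  have hX : fderiv ℝ φ (p, ψ) (fderiv ℝ φ.symm (φ (p, ψ)) ((0, 1), 0)) = ((0, 1), 0) :=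
    hφ.1.fderiv_fderiv_symm hz _
  set X := fderiv ℝ φ.symm (φ (p, ψ)) ((0, 1), 0)
  have hdec : X = X.1.1 • (((1, 0), 0) : Space) + X.1.2 • (((0, 1), w) : Space)
      + (0, X.2 - X.1.2 * w) := by
    ext <;> simp
  have h2 := congrArg Prod.fst hX
  rw [hdec, map_add, map_add, map_smul, map_smul, Prod.fst_add, Prod.fst_add, Prod.smul_fst,
    Prod.smul_fst, h1, hφ.fderiv_vert hz, smul_zero, add_zero, add_zero] at h2
  have h3 : X.1.1 = 0 := by
    have h4 := congrArg Prod.fst h2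
    simp only [Prod.smul_fst, smul_eq_mul] at h4
    exact (mul_eq_zero.1 h4).resolve_right (hφ.fderiv_time_ne_zero hz 0)
  rw [h3, zero_smul] at h2
  simpa using congrArg Prod.snd h2

/-- The derivative along the fibre of the new dependent variable. -/
noncomputable def fibreDeriv (φ : LocalTransf) (z : Space) : ℂ →L[ℝ] ℂ :=
  (ContinuousLinearMap.snd ℝ (ℝ × ℝ) ℂ).comp
    ((fderiv ℝ φ z).comp (ContinuousLinearMap.inr ℝ (ℝ × ℝ) ℂ))

theorem fibreDeriv_apply (φ : LocalTransf) (z : Space) (w : ℂ) :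
    fibreDeriv φ z w = (fderiv ℝ φ z (0, w)).2 := rfl

theorem Admissible.fibreDeriv_injective (hφ : Admissible V V' φ) {z : Space} (hz : z ∈ φ.source)
    {w : ℂ} (hw : fibreDeriv φ z w = 0) : w = 0 :=
  congrArg Prod.snd (hφ.1.fderiv_injective hz (Prod.ext (hφ.fderiv_vert hz w) hw))

/-- The fibre derivative of an admissible transformation is complex linear or antilinear. -/
theorem Admissible.fibreDeriv_I_mul (hφ : Admissible V V' φ) {z : Space} (hz : z ∈ φ.source) :
    (∀ w, fibreDeriv φ z (Complex.I * w) = Complex.I * fibreDeriv φ z w) ∨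
    (∀ w, fibreDeriv φ z (Complex.I * w) = -(Complex.I * fibreDeriv φ z w)) := by
  obtain ⟨p, ψ⟩ := z
  have hΔ := hφ.stretch_ne_zero hz 0
  have h4 := hφ.stretch_pow_four hz hΔ
  obtain ⟨u', -, h⟩ := hφ.exists_transvDeriv hz hΔ
  have hB : transvDeriv φ u' (p, ψ) = fibreDeriv φ (p, ψ) := by
    ext w
    simp [transvDeriv_apply, fibreDeriv_apply, hφ.fderiv_vert hz]
  rw [hB] at h
  have hτ0 : ((fderiv ℝ φ (p, ψ) ((1, 0), 0)).1.1 : ℂ) ≠ 0 := by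
    exact_mod_cast hφ.fderiv_time_ne_zero hz 0
  set Δ := (fderiv ℝ φ (p, ψ) ((0, 1), 0)).1.2
  set τ := (fderiv ℝ φ (p, ψ) ((1, 0), 0)).1.1
  have h5 : (Δ ^ 2) ^ 2 = τ ^ 2 := by rw [← h4]; ring
  rcases sq_eq_sq_iff_eq_or_eq_neg.1 h5 with h6 | h6
  · left
    intro w
    have h7 := h w
    rw [← Complex.ofReal_pow, h6] at h7
    exact (mul_left_cancel₀ hτ0 h7).symm
  · right
    intro w
    have h7 := h w
    rw [← Complex.ofReal_pow, h6, Complex.ofReal_neg] at h7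
    exact mul_left_cancel₀ hτ0 (by linear_combination -h7)

end FirstOrder

/-! ### The form of an admissible transformation -/

section FibreForm

variable {V V' : Potential} {φ : LocalTransf}

theorem Admissible.fderiv_fderiv_vert_fst (hφ : Admissible V V' φ) {z : Space}
    (hz : z ∈ φ.source) (X : Space) (w : ℂ) :
    (fderiv ℝ (fderiv ℝ φ) z X (0, w)).1 = 0 ∧ (fderiv ℝ (fderiv ℝ φ) z (0, w) X).1 = 0 := by
  have hs := hφ.1.contDiffAt hz
  have h1 : (fun y => (fderiv ℝ φ y (0, w)).1) =ᶠ[𝓝 z] fun _ => 0 := by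
    filter_upwards [φ.open_source.mem_nhds hz] with y hy
    exact hφ.fderiv_vert hy w
  have h2 := ((hs.differentiableAt_fderiv.hasFDerivAt).clm_apply
    (hasFDerivAt_const ((0, w) : Space) z)).fst.fderiv
  have h3 := h1.fderiv_eq (𝕜 := ℝ)
  have h4 : fderiv ℝ (fun y => (fderiv ℝ φ y (0, w)).1) z = _ := h2
  rw [h4] at h3
  have h5 : (fderiv ℝ (fderiv ℝ φ) z X (0, w)).1 = 0 := by
    simpa using DFunLike.congr_fun h3 X
  refine ⟨h5, ?_⟩
  rw [(hs.isSymmSndFDerivAt (by simp; norm_cast)).eq (0, w) X]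
  exact h5

/-- The new dependent variable is affine along the fibres, to second order. The test is the second
difference of three functions whose `x`-derivatives are `w`, `0` and `-w`. -/
theorem Admissible.secondDeriv_vert_snd (hφ : Admissible V V' φ) {z : Space} (hz : z ∈ φ.source)
    (w : ℂ) : (secondDeriv φ z (0, w)).2 = 0 := by
  obtain ⟨p, ψ⟩ := z
  have hs := hφ.1
  set a : ℂ := Complex.I * (V.val p * ψ) with ha
  set D := fderiv ℝ φ (p, ψ) with hD
  have hbase : ∀ (v : ℝ × ℝ) (x : ℂ), (D (v, x)).1 = (D (v, 0)).1 := by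
    intro v x
    rw [graph_vec_add D v 0 x, Prod.fst_add, hφ.fderiv_vert hz, add_zero]
  have hinj : ∀ (x : ℂ) (v : ℝ × ℝ), (D (v, v.1 * a + v.2 * x)).1 = 0 → v = 0 := by
    intro x v hv
    have hdec : ((v, v.1 * a + v.2 * x) : Space) =
        v.1 • (((1, 0), a) : Space) + v.2 • (((0, 1), x) : Space) := by
      ext <;> simp
    rw [hdec, map_add, map_smul, map_smul] at hv
    have h1 := congrArg Prod.fst hv
    simp only [Prod.fst_add, Prod.smul_fst, hD, hφ.fderiv_time_eq_zero hz, smul_eq_mul,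
      mul_zero, add_zero, Prod.fst_zero] at h1
    have hv1 : v.1 = 0 := (mul_eq_zero.1 h1).resolve_right (hφ.fderiv_time_ne_zero hz a)
    have h2 := congrArg Prod.snd hv
    rw [hv1] at h2
    simp only [zero_smul, zero_add, Prod.smul_fst, Prod.smul_snd, Prod.snd_zero,
      smul_eq_mul] at h2
    exact Prod.ext hv1 ((mul_eq_zero.1 h2).resolve_right (hφ.stretch_ne_zero hz x))
  have hsol : Complex.I * a + 0 + V.val p * ψ = 0 := by
    rw [ha]; linear_combination (V.val p * ψ) * Complex.I_sq
  obtain ⟨u₀, h₀⟩ := exists_isImage_testFun hs hz a 0 0 0 (hinj 0)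
  obtain ⟨u₁, h₁⟩ := exists_isImage_testFun hs hz a w 0 0 (hinj w)
  obtain ⟨u₂, h₂⟩ := exists_isImage_testFun hs hz a (-w) 0 0 (hinj (-w))
  have s₀ := (hφ.schr_iff h₀).1 (by rw [schr_testFun]; exact hsol)
  have s₁ := (hφ.schr_iff h₁).1 (by rw [schr_testFun]; exact hsol)
  have s₂ := (hφ.schr_iff h₂).1 (by rw [schr_testFun]; exact hsol)
  have v₀ := h₀.maps.2.2.self_of_nhds
  have v₁ := h₁.maps.2.2.self_of_nhds
  have v₂ := h₂.maps.2.2.self_of_nhds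
  have q₀ := h₀.secondDeriv_eq hs (0, 1)
  have q₁ := h₁.secondDeriv_eq hs (0, 1)
  have q₂ := h₂.secondDeriv_eq hs (0, 1)
  have f₀ := h₀.fderiv_eq hs
  have f₁ := h₁.fderiv_eq hs
  have f₂ := h₂.fderiv_eq hs
  have hsurj := h₀.base_surjective hs
  simp only [testFun_self, fderiv_testFun_self, secondDeriv_testFun, Complex.ofReal_zero,
    Complex.ofReal_one, zero_mul, one_mul, zero_add, add_zero, mul_zero, ← hD,
    ne_eq, OfNat.ofNat_ne_zero, not_false_eq_true, zero_pow, Prod.mk_zero_zero, map_zero]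
    at s₀ s₁ s₂ v₀ v₁ v₂ q₀ q₁ q₂ f₀ f₁ f₂ hsurj
  rw [hbase] at q₁ q₂
  set p' := (φ (p, ψ)).1 with hp'
  set Δ := (D ((0, 1), 0)).1.2 with hΔdef
  have hex : (D ((0, 1), 0)).1 = Δ • ((0, 1) : ℝ × ℝ) :=
    Prod.ext (by simpa using hφ.fderiv_time_eq_zero hz 0) (by simp [hΔdef])
  -- the second difference of the images vanishes to first order
  have hfd : ∀ k : ℝ × ℝ, fderiv ℝ u₁ p' k + fderiv ℝ u₂ p' k - 2 * fderiv ℝ u₀ p' k = 0 := by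
    intro k
    obtain ⟨v, hv⟩ := hsurj k
    have e₀ := f₀ v
    have e₁ := f₁ v
    have e₂ := f₂ v
    rw [hbase, hv.symm.trans (hbase _ _) |>.symm] at e₁ e₂
    rw [hv] at e₀
    rw [← e₀, ← e₁, ← e₂, graph_vec_add D v (v.1 * a) (v.1 * a + v.2 * w),
      graph_vec_add D v (v.1 * a) (v.1 * a + v.2 * -w)]
    have hneg : (((0, 0), v.1 * a + v.2 * -w - v.1 * a) : Space) =
        -((0, 0), v.1 * a + v.2 * w - v.1 * a) := by ext <;> simp
    have hneg' := congrArg D hneg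
    rw [map_neg] at hneg'
    change D (0, _) = - D (0, _) at hneg'
    rw [hneg']
    simp only [Prod.snd_add, Prod.snd_neg]
    ring
  set Q := fderiv ℝ (fderiv ℝ φ) (p, ψ) with hQ
  have hadd : ∀ x : ℂ, (((0, 1), x) : Space) = ((0, 1), 0) + (0, x) := by
    intro x; ext <;> simp
  have hq : ∀ x : ℂ, secondDeriv φ (p, ψ) ((0, 1), x) = Q ((0, 1), 0) ((0, 1), 0)
      + Q ((0, 1), 0) (0, x) + Q (0, x) ((0, 1), 0) + Q (0, x) (0, x) := by
    intro x
    rw [secondDeriv, hadd x]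
    simp only [map_add, add_apply]
    abel
  have hQ1 : ∀ (X : Space) (x : ℂ), (Q X (0, x)).1 = 0 := fun X x =>
    (hφ.fderiv_fderiv_vert_fst hz X x).1
  have hQ2 : ∀ (X : Space) (x : ℂ), (Q (0, x) X).1 = 0 := fun X x =>
    (hφ.fderiv_fderiv_vert_fst hz X x).2
  have hnegw : ((0, -w) : Space) = -(0, w) := by ext <;> simp
  rw [hq] at q₀ q₁ q₂
  have hzero : ((0, 0) : Space) = 0 := rfl
  simp only [Prod.fst_add, Prod.snd_add, hQ1, hQ2, add_zero, hnegw, map_neg, neg_apply, neg_neg,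
    Prod.snd_neg, hzero, map_zero, zero_apply, Prod.fst_neg, neg_zero, hex] at q₀ q₁ q₂
  have hk := hfd (Q ((0, 1), 0) ((0, 1), 0)).1
  have ht := hfd (1, 0)
  simp only [secondDeriv, map_smul, smul_apply, Complex.real_smul] at q₀ q₁ q₂
  simp only [schr, secondDeriv] at s₀ s₁ s₂
  rw [v₀] at s₀
  rw [v₁] at s₁
  rw [v₂] at s₂
  have hgoal : (2 : ℂ) * (Q (0, w) (0, w)).2 = 0 := by
    linear_combination q₁ + q₂ - 2 * q₀ + hk + (Δ : ℂ) ^ 2 * (s₁ + s₂ - 2 * s₀)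
      - (Δ : ℂ) ^ 2 * Complex.I * ht
  exact (mul_eq_zero.1 hgoal).resolve_left two_ne_zero

theorem Admissible.fderiv_fderiv_vert_snd (hφ : Admissible V V' φ) {z : Space}
    (hz : z ∈ φ.source) (w w' : ℂ) :
    (fderiv ℝ (fderiv ℝ φ) z (0, w) (0, w')).2 = 0 := by
  have h1 := hφ.secondDeriv_vert_snd hz w
  have h2 := hφ.secondDeriv_vert_snd hz w'
  have h3 := hφ.secondDeriv_vert_snd hz (w + w')
  have hsym := ((hφ.1.contDiffAt hz).isSymmSndFDerivAt (by simp; norm_cast)).eq (0, w) (0, w')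
  have hadd : ((0, w + w') : Space) = (0, w) + (0, w') := by ext <;> simp
  unfold secondDeriv at h1 h2 h3
  rw [hadd] at h3
  simp only [map_add, add_apply, Prod.snd_add, h1, h2, ← hsym] at h3
  have h4 : 2 * (fderiv ℝ (fderiv ℝ φ) z (0, w) (0, w')).2 = 0 := by linear_combination h3
  exact (mul_eq_zero.1 h4).resolve_left two_ne_zero

/-- The fibre over `p` of a set of points `((t, x), ψ)`. -/
def fibre (U : Set Space) (p : ℝ × ℝ) : Set ℂ := {ψ | (p, ψ) ∈ U}

theorem isOpen_fibre {U : Set Space} (hU : IsOpen U) (p : ℝ × ℝ) : IsOpen (fibre U p) :=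
  hU.preimage (by fun_prop)

theorem hasFDerivAt_fibre (hφ : IsSmooth φ) {p : ℝ × ℝ} {ψ : ℂ} (hz : (p, ψ) ∈ φ.source) :
    HasFDerivAt (fun ψ => φ (p, ψ))
      ((fderiv ℝ φ (p, ψ)).comp (ContinuousLinearMap.inr ℝ (ℝ × ℝ) ℂ)) ψ :=
  (hφ.contDiffAt hz).differentiableAt_top.hasFDerivAt.comp ψ (hasFDerivAt_prodMk_right p ψ)

/-- If the new independent variables do not depend on `ψ` to first order, then they are
smooth functions of the old ones, provided that the domain has convex fibres. -/
theorem exists_base (hφ : IsSmooth φ) (hv : ∀ z ∈ φ.source, ∀ w, (fderiv ℝ φ z (0, w)).1 = 0)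
    (hc : FibreConvex φ.source) :
    ∃ b : ℝ × ℝ → ℝ × ℝ, ContDiffOn ℝ ∞ b (Prod.fst '' φ.source) ∧
      ∀ z ∈ φ.source, (φ z).1 = b z.1 := by
  have hconst : ∀ (p : ℝ × ℝ) (ψ ψ' : ℂ), (p, ψ) ∈ φ.source → (p, ψ') ∈ φ.source →
      (φ (p, ψ)).1 = (φ (p, ψ')).1 := by
    intro p ψ ψ' h h'
    refine (isOpen_fibre φ.open_source p).is_const_of_fderiv_eq_zero (𝕜 := ℝ)
      (f := fun ψ => (φ (p, ψ)).1) (hc p).isPreconnected ?_ ?_ h h'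
    · intro y hy
      exact (hasFDerivAt_fibre hφ hy).fst.differentiableAt.differentiableWithinAt
    · intro y hy
      rw [(hasFDerivAt_fibre hφ hy).fst.fderiv]
      exact ContinuousLinearMap.ext fun w => hv _ hy w
  choose! s hs using fun (p : ℝ × ℝ) (hp : p ∈ Prod.fst '' φ.source) =>
    (show ∃ ψ, (p, ψ) ∈ φ.source by
      obtain ⟨z, hz, rfl⟩ := hp; exact ⟨z.2, hz⟩)
  have heq : ∀ z ∈ φ.source, (φ z).1 = (φ (z.1, s z.1)).1 := fun z hz =>
    hconst z.1 z.2 (s z.1) hz (hs z.1 ⟨z, hz, rfl⟩)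
  refine ⟨fun p => (φ (p, s p)).1, ?_, heq⟩
  intro p hp
  have hmem := hs p hp
  have h1 : ContDiffAt ℝ ∞ (fun q => (φ (q, s p)).1) p :=
    contDiffAt_fst.comp p (hφ.contDiffAt_graph (u := fun _ => s p) contDiffAt_const hmem)
  refine (h1.congr_of_eventuallyEq ?_).contDiffWithinAt
  have hcont : ContinuousAt (fun q : ℝ × ℝ => ((q, s p) : Space)) p := by fun_prop
  filter_upwards [hcont.preimage_mem_nhds (φ.open_source.mem_nhds hmem)] with q hq
  exact (heq _ hq).symm

theorem Admissible.fibreDeriv_surjective (hφ : Admissible V V' φ) {z : Space}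
    (hz : z ∈ φ.source) : Function.Surjective (fibreDeriv φ z) := by
  have h : Function.Injective (fibreDeriv φ z : ℂ →ₗ[ℝ] ℂ) := by
    rw [injective_iff_map_eq_zero]
    exact fun w hw => hφ.fibreDeriv_injective hz hw
  exact LinearMap.injective_iff_surjective.1 h

/-- The inverse of an admissible transformation has independent variables that do not depend on the
dependent one, to first order. -/
theorem Admissible.fderiv_symm_vert (hφ : Admissible V V' φ) {z' : Space} (hz : z' ∈ φ.target)
    (w : ℂ) : (fderiv ℝ φ.symm z' (0, w)).1 = 0 := by
  have hz' := φ.map_target hz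
  obtain ⟨w₀, hw₀⟩ := hφ.fibreDeriv_surjective hz' w
  have h1 : fderiv ℝ φ (φ.symm z') (0, w₀) = (0, w) :=
    Prod.ext (hφ.fderiv_vert hz' w₀) hw₀
  have h2 := hφ.1.fderiv_symm_fderiv hz' (0, w₀)
  rw [φ.right_inv hz, h1] at h2
  rw [h2]

theorem Admissible.fibreDeriv_eq (hφ : Admissible V V' φ) (hc : FibreConvex φ.source)
    {p : ℝ × ℝ} {ψ ψ' : ℂ} (h : (p, ψ) ∈ φ.source) (h' : (p, ψ') ∈ φ.source) :
    fibreDeriv φ (p, ψ) = fibreDeriv φ (p, ψ') := by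
  have hd : ∀ y ∈ fibre φ.source p, ∃ L : ℂ →L[ℝ] (ℂ →L[ℝ] ℂ),
      HasFDerivAt (fun ψ => fibreDeriv φ (p, ψ)) L y ∧ L = 0 := by
    intro y hy
    have h1 : HasFDerivAt (fun ψ => fderiv ℝ φ (p, ψ)) _ y :=
      (hφ.1.contDiffAt hy).differentiableAt_fderiv.hasFDerivAt.comp y (hasFDerivAt_prodMk_right p y)
    have h2 := (hasFDerivAt_const (ContinuousLinearMap.snd ℝ (ℝ × ℝ) ℂ) y).clm_comp
      (h1.clm_comp (hasFDerivAt_const (ContinuousLinearMap.inr ℝ (ℝ × ℝ) ℂ) y))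
    refine ⟨_, h2, ?_⟩
    refine ContinuousLinearMap.ext fun w => ContinuousLinearMap.ext fun w' => ?_
    simpa using hφ.fderiv_fderiv_vert_snd hy w w'
  refine (isOpen_fibre φ.open_source p).is_const_of_fderiv_eq_zero (𝕜 := ℝ)
      (f := fun ψ => fibreDeriv φ (p, ψ)) (hc p).isPreconnected ?_ ?_ h h'
  · intro y hy
    obtain ⟨L, hL, -⟩ := hd y hy
    exact hL.differentiableAt.differentiableWithinAt
  · intro y hy
    obtain ⟨L, hL, h0⟩ := hd y hy
    rw [hL.fderiv, h0]; rfl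

theorem Admissible.snd_eq_affine (hφ : Admissible V V' φ) (hc : FibreConvex φ.source)
    {p : ℝ × ℝ} {ψ ψ' : ℂ} (h : (p, ψ) ∈ φ.source) (h' : (p, ψ') ∈ φ.source) :
    (φ (p, ψ')).2 - fibreDeriv φ (p, ψ) ψ' = (φ (p, ψ)).2 - fibreDeriv φ (p, ψ) ψ := by
  refine (isOpen_fibre φ.open_source p).is_const_of_fderiv_eq_zero (𝕜 := ℝ)
      (f := fun y => (φ (p, y)).2 - fibreDeriv φ (p, ψ) y) (hc p).isPreconnected ?_ ?_ h' h
  · intro y hy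
    exact ((hasFDerivAt_fibre hφ.1 hy).snd.sub
      (fibreDeriv φ (p, ψ)).hasFDerivAt).differentiableAt.differentiableWithinAt
  · intro y hy
    have h1 : fderiv ℝ (fun y => (φ (p, y)).2 - fibreDeriv φ (p, ψ) y) y = _ :=
      ((hasFDerivAt_fibre hφ.1 hy).snd.sub (fibreDeriv φ (p, ψ)).hasFDerivAt).fderiv
    rw [h1, hφ.fibreDeriv_eq hc h hy]
    ext w
    simp [fibreDeriv]

/-- `φ` has the form `(p, ψ) ↦ (b p, H p * σ p ψ + K p)`, where `σ p` is the identity or the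
complex conjugation and `b'` is the inverse of `b`; all coefficients are smooth. -/
structure IsFibreAffine (φ : LocalTransf) (b b' : ℝ × ℝ → ℝ × ℝ) (H K : ℝ × ℝ → ℂ)
    (σ : ℝ × ℝ → ℂ →L[ℝ] ℂ) : Prop where
  smooth_b : ContDiffOn ℝ ∞ b (Prod.fst '' φ.source)
  smooth_b' : ContDiffOn ℝ ∞ b' (Prod.fst '' φ.target)
  smooth_H : ContDiffOn ℝ ∞ H (Prod.fst '' φ.source)
  smooth_K : ContDiffOn ℝ ∞ K (Prod.fst '' φ.source)
  smooth_σ : ContDiffOn ℝ ∞ σ (Prod.fst '' φ.source)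
  apply_eq : ∀ z ∈ φ.source, φ z = (b z.1, H z.1 * σ z.1 z.2 + K z.1)
  left_inv : ∀ p ∈ Prod.fst '' φ.source, b' (b p) = p
  H_ne_zero : ∀ p ∈ Prod.fst '' φ.source, H p ≠ 0
  σ_eq : ∀ p ∈ Prod.fst '' φ.source,
    σ p = ContinuousLinearMap.id ℝ ℂ ∨ σ p = (Complex.conjCLE : ℂ →L[ℝ] ℂ)

/-- Up to a complex factor, the fibre derivative is the identity or the complex conjugation. -/
theorem Admissible.fibreDeriv_one_inv_smul (hφ : Admissible V V' φ) {z : Space}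
    (hz : z ∈ φ.source) :
    (fibreDeriv φ z 1)⁻¹ • fibreDeriv φ z = ContinuousLinearMap.id ℝ ℂ ∨
    (fibreDeriv φ z 1)⁻¹ • fibreDeriv φ z = (Complex.conjCLE : ℂ →L[ℝ] ℂ) := by
  have h1 : fibreDeriv φ z 1 ≠ 0 := fun h => one_ne_zero (hφ.fibreDeriv_injective hz h)
  have hw : ∀ w : ℂ, fibreDeriv φ z w =
      w.re * fibreDeriv φ z 1 + w.im * fibreDeriv φ z (Complex.I * 1) := by
    intro w
    have hdec : w = w.re • (1 : ℂ) + w.im • (Complex.I * 1 : ℂ) := by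
      apply Complex.ext <;> simp
    conv_lhs => rw [hdec]
    rw [map_add, map_smul, map_smul, Complex.real_smul, Complex.real_smul]
  rcases hφ.fibreDeriv_I_mul hz with h | h
  · left
    refine ContinuousLinearMap.ext fun w => ?_
    rw [smul_apply, hw w, h 1, smul_eq_mul]
    field_simp
    simp only [ContinuousLinearMap.id_apply]
    conv_rhs => rw [← Complex.re_add_im w]
  · right
    refine ContinuousLinearMap.ext fun w => ?_
    rw [smul_apply, hw w, h 1, smul_eq_mul]
    field_simp
    apply Complex.ext <;> simp

theorem contDiffAt_fibreDeriv (hφ : IsSmooth φ) {p : ℝ × ℝ} {ψ : ℂ} (hz : (p, ψ) ∈ φ.source) :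
    ContDiffAt ℝ ∞ (fun q => fibreDeriv φ (q, ψ)) p := by
  have h1 : ContDiffAt ℝ ∞ (fderiv ℝ φ) (p, ψ) :=
    (hφ.contDiffAt hz).fderiv_right (by norm_cast)
  have h2 : ContDiffAt ℝ ∞ (fun q : ℝ × ℝ => fderiv ℝ φ (q, ψ)) p :=
    h1.comp p (contDiffAt_id.prodMk contDiffAt_const)
  exact contDiffAt_const.clm_comp (h2.clm_comp contDiffAt_const)

theorem Admissible.exists_isFibreAffine (hφ : Admissible V V' φ) (hc : FibreConvex φ.source)
    {b' : ℝ × ℝ → ℝ × ℝ} (hb' : ContDiffOn ℝ ∞ b' (Prod.fst '' φ.target))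
    (hb'eq : ∀ z ∈ φ.target, (φ.symm z).1 = b' z.1) :
    ∃ b H K σ, IsFibreAffine φ b b' H K σ := by
  obtain ⟨b, hb, hbeq⟩ := exists_base hφ.1 (fun z hz w => hφ.fderiv_vert hz w) hc
  choose! s hs using fun (p : ℝ × ℝ) (hp : p ∈ Prod.fst '' φ.source) =>
    (show ∃ ψ, (p, ψ) ∈ φ.source by
      obtain ⟨z, hz, rfl⟩ := hp; exact ⟨z.2, hz⟩)
  set A : ℝ × ℝ → ℂ →L[ℝ] ℂ := fun p => fibreDeriv φ (p, s p) with hA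
  have hAeq : ∀ p ψ, (p, ψ) ∈ φ.source → A p = fibreDeriv φ (p, ψ) := fun p ψ h =>
    hφ.fibreDeriv_eq hc (hs p ⟨_, h, rfl⟩) h
  have hev : ∀ p ∈ Prod.fst '' φ.source, ∀ᶠ q in 𝓝 p, (q, s p) ∈ φ.source := by
    intro p hp
    have hcont : ContinuousAt (fun q : ℝ × ℝ => ((q, s p) : Space)) p := by fun_prop
    exact hcont.preimage_mem_nhds (φ.open_source.mem_nhds (hs p hp))
  have hAs : ∀ p ∈ Prod.fst '' φ.source, ContDiffAt ℝ ∞ A p := by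
    intro p hp
    refine (contDiffAt_fibreDeriv hφ.1 (hs p hp)).congr_of_eventuallyEq ?_
    filter_upwards [hev p hp] with q hq
    exact hAeq q _ hq
  have hHs : ∀ p ∈ Prod.fst '' φ.source, ContDiffAt ℝ ∞ (fun p => A p 1) p := fun p hp =>
    (hAs p hp).clm_apply contDiffAt_const
  have hH0 : ∀ p ∈ Prod.fst '' φ.source, A p 1 ≠ 0 := fun p hp h =>
    one_ne_zero (hφ.fibreDeriv_injective (hs p hp) h)
  refine ⟨b, fun p => A p 1, fun p => (φ (p, s p)).2 - A p (s p), fun p => (A p 1)⁻¹ • A p,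
    hb, hb', fun p hp => (hHs p hp).contDiffWithinAt, fun p hp => ?_, fun p hp => ?_, ?_, ?_,
    hH0, fun p hp => hφ.fibreDeriv_one_inv_smul (hs p hp)⟩
  · have h1 : ContDiffAt ℝ ∞ (fun q => (φ (q, s p)).2 - A q (s p)) p :=
      (contDiffAt_snd.comp p (hφ.1.contDiffAt_graph (u := fun _ => s p) contDiffAt_const
        (hs p hp))).sub ((hAs p hp).clm_apply contDiffAt_const)
    refine (h1.congr_of_eventuallyEq ?_).contDiffWithinAt
    filter_upwards [hev p hp] with q hq
    exact (hφ.snd_eq_affine hc (hs q ⟨_, hq, rfl⟩) hq).symm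
  · exact (((hHs p hp).inv (hH0 p hp)).smul (hAs p hp)).contDiffWithinAt
  · intro z hz
    have hp : z.1 ∈ Prod.fst '' φ.source := ⟨z, hz, rfl⟩
    refine Prod.ext (hbeq z hz) ?_
    have h1 := hφ.snd_eq_affine hc (hs z.1 hp) (ψ' := z.2) hz
    have h2 : A z.1 1 * ((A z.1 1)⁻¹ • A z.1) z.2 = A z.1 z.2 := by
      rw [smul_apply, smul_eq_mul, mul_inv_cancel_left₀ (hH0 _ hp)]
    simp only [h2]
    exact sub_eq_iff_eq_add'.1 h1
  · intro p hp
    rw [← hbeq (p, s p) (hs p hp), ← hb'eq _ (φ.map_source (hs p hp)), φ.left_inv (hs p hp)]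

end FibreForm

/-! ### The linear part of an admissible transformation -/

section LinearPart

variable {V V' : Potential} {φ : LocalTransf} {b b' : ℝ × ℝ → ℝ × ℝ} {H K : ℝ × ℝ → ℂ}
  {σ : ℝ × ℝ → ℂ →L[ℝ] ℂ} {p : ℝ × ℝ}

theorem isOpen_image_fst {U : Set Space} (hU : IsOpen U) : IsOpen (Prod.fst '' U) :=
  isOpenMap_fst U hU

theorem contDiffAt_of_source {E : Type*} [NormedAddCommGroup E] [NormedSpace ℝ E]
    {f : ℝ × ℝ → E} (hf : ContDiffOn ℝ ∞ f (Prod.fst '' φ.source))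
    (hp : p ∈ Prod.fst '' φ.source) : ContDiffAt ℝ ∞ f p :=
  hf.contDiffAt ((isOpen_image_fst φ.open_source).mem_nhds hp)

namespace IsFibreAffine

theorem b_mem (hd : IsFibreAffine φ b b' H K σ) (hp : p ∈ Prod.fst '' φ.source) :
    b p ∈ Prod.fst '' φ.target := by
  obtain ⟨z, hz, rfl⟩ := hp
  exact ⟨φ z, φ.map_source hz, by rw [hd.apply_eq z hz]⟩

theorem b'_mem (hd : IsFibreAffine φ b b' H K σ) (hp : p ∈ Prod.fst '' φ.target) :
    b' p ∈ Prod.fst '' φ.source ∧ b (b' p) = p := by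
  obtain ⟨z, hz, rfl⟩ := hp
  have h1 : z.1 = b (φ.symm z).1 := by
    have := congrArg Prod.fst (hd.apply_eq _ (φ.map_target hz))
    rwa [φ.right_inv hz] at this
  have h2 : (φ.symm z).1 ∈ Prod.fst '' φ.source := ⟨_, φ.map_target hz, rfl⟩
  rw [h1, hd.left_inv _ h2]
  exact ⟨h2, rfl⟩

theorem symm_fst (hd : IsFibreAffine φ b b' H K σ) {z : Space} (hz : z ∈ φ.target) :
    (φ.symm z).1 = b' z.1 := by
  have h2 : (φ.symm z).1 ∈ Prod.fst '' φ.source := ⟨_, φ.map_target hz, rfl⟩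
  have h1 := congrArg Prod.fst (hd.apply_eq _ (φ.map_target hz))
  rw [φ.right_inv hz] at h1
  rw [h1, hd.left_inv _ h2]

theorem contDiffAt_b' (hd : IsFibreAffine φ b b' H K σ) (hp : p ∈ Prod.fst '' φ.source) :
    ContDiffAt ℝ ∞ b' (b p) :=
  hd.smooth_b'.contDiffAt ((isOpen_image_fst φ.open_target).mem_nhds (hd.b_mem hp))

theorem σ_mul (hd : IsFibreAffine φ b b' H K σ) (hp : p ∈ Prod.fst '' φ.source) (x y : ℂ) :
    σ p (x * y) = σ p x * σ p y := by
  rcases hd.σ_eq p hp with h | h <;> rw [h] <;> simp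

theorem σ_σ (hd : IsFibreAffine φ b b' H K σ) (hp : p ∈ Prod.fst '' φ.source) (x : ℂ) :
    σ p (σ p x) = x := by
  rcases hd.σ_eq p hp with h | h <;> rw [h] <;> simp

theorem σ_ofReal (hd : IsFibreAffine φ b b' H K σ) (hp : p ∈ Prod.fst '' φ.source) (x : ℝ) :
    σ p x = x := by
  rcases hd.σ_eq p hp with h | h <;> rw [h] <;> simp

/-- The pull-back of a function along `b'` is smooth at `b p`. -/
theorem contDiffAt_comp_b' (hd : IsFibreAffine φ b b' H K σ) {E : Type*} [NormedAddCommGroup E]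
    [NormedSpace ℝ E] {f : ℝ × ℝ → E} (hp : p ∈ Prod.fst '' φ.source)
    (hf : ContDiffAt ℝ ∞ f p) : ContDiffAt ℝ ∞ (fun q => f (b' q)) (b p) := by
  have hf' : ContDiffAt ℝ ∞ f (b' (b p)) := by rwa [hd.left_inv p hp]
  exact hf'.comp (b p) (hd.contDiffAt_b' hp)

theorem eventually_left_inv (hd : IsFibreAffine φ b b' H K σ) (hp : p ∈ Prod.fst '' φ.source) :
    ∀ᶠ q in 𝓝 p, q ∈ Prod.fst '' φ.source ∧ b' (b q) = q := by
  filter_upwards [(isOpen_image_fst φ.open_source).mem_nhds hp] with q hq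
  exact ⟨hq, hd.left_inv q hq⟩

theorem isImage (hd : IsFibreAffine φ b b' H K σ) {u u' : ℝ × ℝ → ℂ}
    (hz : (p, u p) ∈ φ.source) (hu : ContDiffAt ℝ ∞ u p) (hu' : ContDiffAt ℝ ∞ u' (b p))
    (h : ∀ᶠ q in 𝓝 p, u' (b q) = H q * σ q (u q) + K q) : IsImage φ u u' p := by
  have hb : (φ (p, u p)).1 = b p := by rw [hd.apply_eq _ hz]
  refine ⟨hu, by rwa [hb], hz, rfl, ?_⟩
  have hcont : ContinuousAt (fun q : ℝ × ℝ => ((q, u q) : Space)) p :=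
    continuousAt_id.prodMk hu.continuousAt
  filter_upwards [h, hcont.preimage_mem_nhds (φ.open_source.mem_nhds hz)] with q hq hqs
  rw [hd.apply_eq _ hqs]
  exact hq

theorem of_mapsGraphAt (hd : IsFibreAffine φ b b' H K σ) {u u' : ℝ × ℝ → ℂ} {p' : ℝ × ℝ}
    (hu : ContDiffAt ℝ ∞ u p) (h : MapsGraphAt φ u u' p p') :
    p' = b p ∧ ∀ᶠ q in 𝓝 p, u' (b q) = H q * σ q (u q) + K q := by
  have hcont : ContinuousAt (fun q : ℝ × ℝ => ((q, u q) : Space)) p :=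
    continuousAt_id.prodMk hu.continuousAt
  refine ⟨by rw [← h.2.1, hd.apply_eq _ h.1], ?_⟩
  filter_upwards [h.2.2, hcont.preimage_mem_nhds (φ.open_source.mem_nhds h.1)] with q hq hqs
  rwa [hd.apply_eq _ hqs] at hq

end IsFibreAffine

/-- The fibre over `p` of an open set that contains `(p, ψ)` contains a point `ψ + δ * w` with a
nonzero real `δ`. -/
theorem exists_real_ne_zero_mem {U : Set Space} (hU : IsOpen U) {ψ : ℂ} (hz : (p, ψ) ∈ U)
    (w : ℂ) : ∃ δ : ℝ, δ ≠ 0 ∧ (p, ψ + (δ : ℂ) * w) ∈ U := by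
  have hcont : ContinuousAt (fun δ : ℝ => ((p, ψ + (δ : ℂ) * w) : Space)) 0 := by fun_prop
  have h1 : ∀ᶠ δ : ℝ in 𝓝 0, (p, ψ + (δ : ℂ) * w) ∈ U :=
    hcont.preimage_mem_nhds (hU.mem_nhds (by simpa using hz))
  have h2 := (h1.filter_mono nhdsWithin_le_nhds).and
    (self_mem_nhdsWithin : {0}ᶜ ∈ 𝓝[≠] (0 : ℝ))
  obtain ⟨δ, hδ, hδ0⟩ := h2.exists
  exact ⟨δ, hδ0, hδ⟩

/-- There are a function that solves the equation at `p` and whose graph meets the domain over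
`p`, and its image, which solves the transformed equation at `b p`. -/
theorem Admissible.exists_solution (hφ : Admissible V V' φ) (hd : IsFibreAffine φ b b' H K σ)
    (hp : p ∈ Prod.fst '' φ.source) : ∃ u u' : ℝ × ℝ → ℂ, ContDiffAt ℝ ∞ u p ∧
      ContDiffAt ℝ ∞ u' (b p) ∧ (p, u p) ∈ φ.source ∧
      (∀ᶠ q in 𝓝 p, u' (b q) = H q * σ q (u q) + K q) ∧
      schr V u p = 0 ∧ schr V' u' (b p) = 0 := by
  obtain ⟨⟨p₁, ψ⟩, hz, rfl : p₁ = p⟩ := id hp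
  set u := testFun p₁ ψ 0 0 (-(V.val p₁ * ψ)) 0 with hu
  have hus : ContDiffAt ℝ ∞ u p₁ := (contDiff_testFun _ _ _ _ _ _).contDiffAt
  have hs : schr V u p₁ = 0 := by rw [hu, schr_testFun]; ring
  have hzu : (p₁, u p₁) ∈ φ.source := by simpa [hu] using hz
  set u' : ℝ × ℝ → ℂ := fun q => (fun q => H q * σ q (u q) + K q) (b' q) with hu'
  have hus' : ContDiffAt ℝ ∞ u' (b p₁) := hd.contDiffAt_comp_b' hp
    (((contDiffAt_of_source hd.smooth_H hp).mul
      ((contDiffAt_of_source hd.smooth_σ hp).clm_apply hus)).add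
      (contDiffAt_of_source hd.smooth_K hp))
  have hev : ∀ᶠ q in 𝓝 p₁, u' (b q) = H q * σ q (u q) + K q := by
    filter_upwards [hd.eventually_left_inv hp] with q hq
    simp only [hu', hq.2]
  have hs' := (hφ.schr_iff (hd.isImage hzu hus hus' hev)).1 hs
  rw [hd.apply_eq _ hzu] at hs'
  exact ⟨u, u', hus, hus', hzu, hev, hs, hs'⟩

/-- The linear part of an admissible transformation relates the two homogeneous equations: add a
small multiple of the given function to a function that solves the equation at the point and
whose graph lies in the domain. -/
theorem Admissible.schr_linear_iff (hφ : Admissible V V' φ) (hd : IsFibreAffine φ b b' H K σ)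
    (hp : p ∈ Prod.fst '' φ.source) {u u' : ℝ × ℝ → ℂ} (hu : ContDiffAt ℝ ∞ u p)
    (hu' : ContDiffAt ℝ ∞ u' (b p)) (h : ∀ᶠ q in 𝓝 p, u' (b q) = H q * σ q (u q)) :
    schr V u p = 0 ↔ schr V' u' (b p) = 0 := by
  obtain ⟨u₀, u₀', hu₀s, hu₀s', hz₀, hev₀, hs₀, hs₀'⟩ := hφ.exists_solution hd hp
  obtain ⟨δ, hδ0, hδ⟩ := exists_real_ne_zero_mem φ.open_source hz₀ (u p)
  have himg : IsImage φ (fun q => u₀ q + (δ : ℂ) * u q) (fun q => u₀' q + (δ : ℂ) * u' q) p := by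
    refine hd.isImage hδ (hu₀s.add (contDiffAt_const.mul hu))
      (hu₀s'.add (contDiffAt_const.mul hu')) ?_
    filter_upwards [hev₀, h, hd.eventually_left_inv hp] with q h1 h2 h3
    rw [h1, h2, map_add, hd.σ_mul h3.1, hd.σ_ofReal h3.1]
    ring
  have h1 := hφ.schr_iff himg
  rw [hd.apply_eq _ hδ, schr_add_const_mul hu₀s hu, schr_add_const_mul hu₀s' hu', hs₀, hs₀'] at h1
  have hδ0' : (δ : ℂ) ≠ 0 := by exact_mod_cast hδ0
  simpa [hδ0'] using h1

section SquareTest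

variable {E : Type*} [NormedAddCommGroup E] [NormedSpace ℝ E]

/-- First and second derivatives of `m * y ^ 2 / 2` at a zero of `y`. -/
theorem deriv_mul_sq {m : E → ℂ} {y : E → ℝ} {x : E} (hm : ContDiffAt ℝ ∞ m x)
    (hy : ContDiffAt ℝ ∞ y x) (h0 : y x = 0) (v : E) :
    fderiv ℝ (fun q => m q * ((y q ^ 2 / 2 : ℝ) : ℂ)) x v = 0 ∧
    secondDeriv (fun q => m q * ((y q ^ 2 / 2 : ℝ) : ℂ)) x v =
      m x * ((fderiv ℝ y x v : ℝ) : ℂ) ^ 2 := by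
  have hf : ∀ q, DifferentiableAt ℝ m q → DifferentiableAt ℝ y q →
      fderiv ℝ (fun q => m q * ((y q ^ 2 / 2 : ℝ) : ℂ)) q v =
      (y q : ℂ) * ((y q : ℂ) / 2 * fderiv ℝ m q v + m q * (fderiv ℝ y q v : ℝ)) := by
    intro q hm hy
    have h1 : HasFDerivAt (fun q => ((y q : ℝ) : ℂ)) (Complex.ofRealCLM.comp (fderiv ℝ y q)) q :=
      Complex.ofRealCLM.hasFDerivAt.comp q hy.hasFDerivAt
    have h2 := (hm.hasFDerivAt.mul (h1.mul h1)).mul_const ((2 : ℂ)⁻¹)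
    have h3 : (fun q => m q * ((y q ^ 2 / 2 : ℝ) : ℂ)) =
        fun q => (m q * ((y q : ℂ) * (y q : ℂ))) * (2 : ℂ)⁻¹ := by
      funext q; push_cast; ring
    have h4 : fderiv ℝ (fun q => (m q * ((y q : ℂ) * (y q : ℂ))) * (2 : ℂ)⁻¹) q = _ := h2.fderiv
    rw [h3, h4]
    simp
    ring
  have hsm : ContDiffAt ℝ ∞ (fun q => m q * ((y q ^ 2 / 2 : ℝ) : ℂ)) x :=
    hm.mul (Complex.ofRealCLM.contDiff.contDiffAt.comp x ((hy.pow 2).div_const 2))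
  refine ⟨by rw [hf x hm.differentiableAt_top hy.differentiableAt_top, h0]; simp, ?_⟩
  rw [secondDeriv_eq_fderiv_apply hsm]
  have hev : (fun q => fderiv ℝ (fun q => m q * ((y q ^ 2 / 2 : ℝ) : ℂ)) q v) =ᶠ[𝓝 x]
      fun q => (y q : ℂ) * ((y q : ℂ) / 2 * fderiv ℝ m q v + m q * (fderiv ℝ y q v : ℝ)) := by
    filter_upwards [hm.eventually_differentiableAt, hy.eventually_differentiableAt] with q h1 h2
    exact hf q h1 h2
  have h1 : HasFDerivAt (fun q => ((y q : ℝ) : ℂ)) (Complex.ofRealCLM.comp (fderiv ℝ y x)) x :=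
    Complex.ofRealCLM.hasFDerivAt.comp x hy.differentiableAt_top.hasFDerivAt
  have h2 : DifferentiableAt ℝ
      (fun q => (y q : ℂ) / 2 * fderiv ℝ m q v + m q * (fderiv ℝ y q v : ℝ)) x := by
    have hm' : DifferentiableAt ℝ (fun q => fderiv ℝ m q v) x :=
      hm.differentiableAt_fderiv.clm_apply (differentiableAt_const v)
    have hy' : DifferentiableAt ℝ (fun q => ((fderiv ℝ y q v : ℝ) : ℂ)) x :=
      Complex.ofRealCLM.differentiableAt.comp x
        (hy.differentiableAt_fderiv.clm_apply (differentiableAt_const v))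
    have h1' : DifferentiableAt ℝ (fun q => (y q : ℂ) / 2) x := by
      simp only [div_eq_mul_inv]
      exact h1.differentiableAt.mul_const _
    exact (h1'.mul hm').add (hm.differentiableAt_top.mul hy')
  have h3 := (h1.mul h2.hasFDerivAt).fderiv
  rw [hev.fderiv_eq]
  have h4 : fderiv ℝ (fun q => (y q : ℂ) *
    ((y q : ℂ) / 2 * fderiv ℝ m q v + m q * (fderiv ℝ y q v : ℝ))) x = _ := h3
  rw [h4]
  simp [h0]
  ring

end SquareTest

/-- The square of the derivative of the old space variable with respect to the new one. -/
noncomputable def rate (b b' : ℝ × ℝ → ℝ × ℝ) (p : ℝ × ℝ) : ℝ := (fderiv ℝ b' (b p) (0, 1)).2 ^ 2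

namespace IsFibreAffine

/-- The linear part of the image of `w * (x - x₀) ^ 2 / 2`. -/
noncomputable def squareImage (b' : ℝ × ℝ → ℝ × ℝ) (H : ℝ × ℝ → ℂ) (σ : ℝ × ℝ → ℂ →L[ℝ] ℂ)
    (p : ℝ × ℝ) (w : ℂ) (q : ℝ × ℝ) : ℂ :=
  (H (b' q) * σ (b' q) w) * ((((b' q).2 - p.2) ^ 2 / 2 : ℝ) : ℂ)

theorem squareImage_spec (hd : IsFibreAffine φ b b' H K σ) (hp : p ∈ Prod.fst '' φ.source)
    (V' : Potential) (w : ℂ) :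
    ContDiffAt ℝ ∞ (squareImage b' H σ p w) (b p) ∧
    (∀ᶠ q in 𝓝 p, squareImage b' H σ p w (b q) = H q * σ q (w * testFun p 0 0 0 1 0 q)) ∧
    schr V' (squareImage b' H σ p w) (b p) = H p * rate b b' p * σ p w := by
  have hm : ContDiffAt ℝ ∞ (fun q => (fun q => H q * σ q w) (b' q)) (b p) :=
    hd.contDiffAt_comp_b' hp ((contDiffAt_of_source hd.smooth_H hp).mul
      ((contDiffAt_of_source hd.smooth_σ hp).clm_apply contDiffAt_const))
  have hy2 : ContDiffAt ℝ ∞ (fun q => (b' q).2) (b p) :=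
    contDiffAt_snd.comp (b p) (hd.contDiffAt_b' hp)
  have hy : ContDiffAt ℝ ∞ (fun q => (b' q).2 - p.2) (b p) := hy2.sub contDiffAt_const
  have hinv := hd.left_inv p hp
  have h0 : (b' (b p)).2 - p.2 = 0 := by rw [hinv, sub_self]
  have hder := deriv_mul_sq hm hy h0
  refine ⟨hm.mul (Complex.ofRealCLM.contDiff.contDiffAt.comp (b p) ((hy.pow 2).div_const 2)),
    ?_, ?_⟩
  · filter_upwards [hd.eventually_left_inv hp] with q hq
    simp only [squareImage, hq.2]
    have : testFun p 0 0 0 1 0 q = (((q.2 - p.2) ^ 2 / 2 : ℝ) : ℂ) := by simp [testFun]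
    rw [this, hd.σ_mul hq.1, hd.σ_ofReal hq.1]
    ring
  · have hfd : fderiv ℝ (fun q => (b' q).2 - p.2) (b p) (0, 1) =
        (fderiv ℝ b' (b p) (0, 1)).2 := by
      rw [fderiv_sub_const, fderiv_snd_apply (hd.contDiffAt_b' hp).differentiableAt_top]
    have e1 := (hder (1, 0)).1
    have e2 := (hder (0, 1)).2
    simp only [hinv] at e2
    rw [hfd] at e2
    unfold schr
    have e3 : squareImage b' H σ p w (b p) = 0 := by
      simp only [squareImage, h0]; simp
    rw [e3]
    have e1' : fderiv ℝ (squareImage b' H σ p w) (b p) (1, 0) = 0 := e1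
    have e2' : secondDeriv (squareImage b' H σ p w) (b p) (0, 1) = _ := e2
    rw [e1', e2', rate]
    push_cast
    ring

end IsFibreAffine

theorem Admissible.rate_ne_zero (hφ : Admissible V V' φ) (hd : IsFibreAffine φ b b' H K σ)
    (hp : p ∈ Prod.fst '' φ.source) : rate b b' p ≠ 0 := by
  intro h0
  obtain ⟨h1, h2, h3⟩ := hd.squareImage_spec hp V' 1
  have hq : ContDiffAt ℝ ∞ (fun q => 1 * testFun p 0 0 0 1 0 q) p :=
    contDiffAt_const.mul (contDiff_testFun _ _ _ _ _ _).contDiffAt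
  have h4 := (hφ.schr_linear_iff hd hp hq h1 h2).2 (by rw [h3, h0]; simp)
  simp only [one_mul] at h4
  rw [schr_testFun] at h4
  simp at h4

/-- The linear part of an admissible transformation multiplies the left-hand sides of the
equations by a nonvanishing function (up to conjugation): after a multiple of `(x - x₀) ^ 2 / 2`
is subtracted, any function solves the equation at the point. -/
theorem Admissible.schr_linear (hφ : Admissible V V' φ) (hd : IsFibreAffine φ b b' H K σ)
    (hp : p ∈ Prod.fst '' φ.source) {u u' : ℝ × ℝ → ℂ} (hu : ContDiffAt ℝ ∞ u p)
    (hu' : ContDiffAt ℝ ∞ u' (b p)) (h : ∀ᶠ q in 𝓝 p, u' (b q) = H q * σ q (u q)) :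
    schr V' u' (b p) = H p * rate b b' p * σ p (schr V u p) := by
  set w := schr V u p with hw
  obtain ⟨h1, h2, h3⟩ := hd.squareImage_spec hp V' w
  have hq : ContDiffAt ℝ ∞ (testFun p 0 0 0 1 0) p := (contDiff_testFun _ _ _ _ _ _).contDiffAt
  have h4 := (hφ.schr_linear_iff hd hp (u := fun q => u q + (-w) * testFun p 0 0 0 1 0 q)
    (u' := fun q => u' q + (-1) * IsFibreAffine.squareImage b' H σ p w q)
    (hu.add (contDiffAt_const.mul hq)) (hu'.add (contDiffAt_const.mul h1)) (by
      filter_upwards [h, h2] with q e1 e2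
      rw [e1, e2, map_add, neg_mul w, map_neg]
      ring)).1 (by rw [schr_add_const_mul hu hq, schr_testFun, ← hw]; simp)
  rw [schr_add_const_mul hu' h1, h3] at h4
  linear_combination h4

end LinearPart

/-! ### Linear superposition transformations -/

section Shift

variable {V : Potential} {ν ν' : LocalTransf} {Φ Φ' : ℝ × ℝ → ℂ}

/-- `ν` is the transformation `ψ ↦ ψ + Φ(t, x)` with a smooth `Φ`. -/
structure IsShift (ν : LocalTransf) (Φ : ℝ × ℝ → ℂ) : Prop where
  smooth : ContDiffOn ℝ ∞ Φ (Prod.fst '' ν.source)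
  apply_eq : ∀ z ∈ ν.source, ν z = (z.1, z.2 + Φ z.1)

theorem mem_linGroup : ν ∈ linGroup V ↔ ν.source ⊆ above V.dom ∧ ∃ Φ, IsShift ν Φ ∧
    ∀ p ∈ Prod.fst '' ν.source, SolvesAt V Φ p :=
  ⟨fun ⟨h, Φ, h1, h2, h3⟩ => ⟨h, Φ, ⟨h1, h3⟩, h2⟩, fun ⟨h, Φ, h1, h2⟩ => ⟨h, Φ, h1.1, h2, h1.2⟩⟩

namespace IsShift

theorem symm_apply (h : IsShift ν Φ) {z : Space} (hz : z ∈ ν.target) :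
    ν.symm z = (z.1, z.2 - Φ z.1) := by
  have h1 := h.apply_eq _ (ν.map_target hz)
  rw [ν.right_inv hz] at h1
  obtain ⟨h2, h3⟩ : z.1 = (ν.symm z).1 ∧ z.2 = (ν.symm z).2 + Φ (ν.symm z).1 :=
    Prod.ext_iff.1 h1
  refine Prod.ext h2.symm ?_
  rw [h3, ← h2]; simp

theorem image_target (h : IsShift ν Φ) : Prod.fst '' ν.target = Prod.fst '' ν.source := by
  ext p
  constructor
  · rintro ⟨z, hz, rfl⟩
    exact ⟨_, ν.map_target hz, by rw [h.symm_apply hz]⟩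
  · rintro ⟨z, hz, rfl⟩
    exact ⟨_, ν.map_source hz, by rw [h.apply_eq z hz]⟩

theorem symm (h : IsShift ν Φ) : IsShift ν.symm (fun p => -Φ p) := by
  refine ⟨?_, fun z hz => ?_⟩
  · have : Prod.fst '' ν.symm.source = Prod.fst '' ν.source := h.image_target
    rw [this]
    exact h.smooth.neg
  · rw [h.symm_apply hz, sub_eq_add_neg]

theorem trans (h : IsShift ν Φ) (h' : IsShift ν' Φ') :
    IsShift (ν.trans ν') (fun p => Φ p + Φ' p) ∧
    Prod.fst '' (ν.trans ν').source ⊆ Prod.fst '' ν.source ∩ Prod.fst '' ν'.source := by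
  have hsub : Prod.fst '' (ν.trans ν').source ⊆ Prod.fst '' ν.source ∩ Prod.fst '' ν'.source := by
    rintro _ ⟨z, hz, rfl⟩
    rw [OpenPartialHomeomorph.trans_source] at hz
    exact ⟨⟨z, hz.1, rfl⟩, ⟨_, hz.2, by rw [h.apply_eq z hz.1]⟩⟩
  refine ⟨⟨(h.smooth.mono fun p hp => (hsub hp).1).add (h'.smooth.mono fun p hp => (hsub hp).2),
    fun z hz => ?_⟩, hsub⟩
  rw [OpenPartialHomeomorph.trans_source] at hz
  have h1 : ν z ∈ ν'.source := hz.2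
  rw [OpenPartialHomeomorph.coe_trans, Function.comp_apply, h'.apply_eq _ h1, h.apply_eq _ hz.1]
  simp [add_assoc]

theorem contDiffOn (h : IsShift ν Φ) : ContDiffOn ℝ ∞ ν ν.source := by
  have h1 : ContDiffOn ℝ ∞ (fun z : Space => (z.1, z.2 + Φ z.1)) ν.source :=
    contDiff_fst.contDiffOn.prodMk (contDiff_snd.contDiffOn.add
      (h.smooth.comp contDiff_fst.contDiffOn fun z hz => ⟨z, hz, rfl⟩))
  exact h1.congr h.apply_eq

theorem isSmooth (h : IsShift ν Φ) : IsSmooth ν := ⟨h.contDiffOn, h.symm.contDiffOn⟩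

end IsShift

theorem linGroup_subset_symGroup (V : Potential) : linGroup V ⊆ symGroup V := by
  intro ν hν
  obtain ⟨hdom, Φ, hs, hsol⟩ := mem_linGroup.1 hν
  refine ⟨hs.isSmooth, hdom, fun z hz => ?_, ?_⟩
  · have h1 := hdom (ν.map_target hz)
    rw [hs.symm_apply hz] at h1
    exact h1
  · intro u u' p p' hu hu' hm
    have hp : p ∈ Prod.fst '' ν.source := ⟨_, hm.1, rfl⟩
    have hpp : p = p' := by
      have := hm.2.1
      rwa [hs.apply_eq _ hm.1] at this
    subst hpp
    have hΦ := contDiffAt_of_source hs.smooth hp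
    have hcont : ContinuousAt (fun q : ℝ × ℝ => ((q, u q) : Space)) p :=
      continuousAt_id.prodMk hu.continuousAt
    have hev : u' =ᶠ[𝓝 p] fun q => u q + 1 * Φ q := by
      filter_upwards [hm.2.2, hcont.preimage_mem_nhds (ν.open_source.mem_nhds hm.1)] with q h1 h2
      rw [hs.apply_eq _ h2] at h1
      rw [one_mul]
      exact h1
    rw [solvesAt_iff hu, solvesAt_iff hu', schr_congr hev, schr_add_const_mul hu hΦ,
      (solvesAt_iff hΦ).1 (hsol p hp), mul_zero, add_zero]

theorem ofSet_mem_linGroup (V : Potential) {U : Set Space} (hU : IsOpen U)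
    (hUV : U ⊆ above V.dom) : OpenPartialHomeomorph.ofSet U hU ∈ linGroup V := by
  refine mem_linGroup.2 ⟨hUV, fun _ => 0, ⟨contDiffOn_const, fun z _ => by simp⟩, fun p _ => ?_⟩
  simp [SolvesAt]

theorem linGroup_isSymSubgroup (V : Potential) : IsSymSubgroup V (linGroup V) where
  subset := linGroup_subset_symGroup V
  id_mem _ hU hUV := ofSet_mem_linGroup V hU hUV
  symm_mem := by
    intro ν hν
    have htar := (linGroup_subset_symGroup V hν).2.2.1
    obtain ⟨-, Φ, hs, hsol⟩ := mem_linGroup.1 hν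
    refine mem_linGroup.2 ⟨htar, _, hs.symm, fun p hp => ?_⟩
    have hp' : p ∈ Prod.fst '' ν.source := by rw [← hs.image_target]; exact hp
    have hΦ := contDiffAt_of_source hs.smooth hp'
    have h1 := (solvesAt_iff hΦ).1 (hsol p hp')
    have h2 : (fun p => -Φ p) = fun p => 0 + (-1) * Φ p := by funext q; ring
    have h3 : schr V (fun _ => 0) p = 0 := by
      rw [← solvesAt_iff contDiffAt_const]; simp [SolvesAt]
    rw [solvesAt_iff hΦ.neg, h2, schr_add_const_mul contDiffAt_const hΦ, h1, h3]
    simp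
  trans_mem := by
    intro ν hν ν' hν'
    obtain ⟨hdom, Φ, hs, hsol⟩ := mem_linGroup.1 hν
    obtain ⟨-, Φ', hs', hsol'⟩ := mem_linGroup.1 hν'
    obtain ⟨ht, hsub⟩ := hs.trans hs'
    refine mem_linGroup.2 ⟨fun z hz => hdom hz.1, _, ht, fun p hp => ?_⟩
    obtain ⟨h1, h2⟩ := hsub hp
    have e1 := contDiffAt_of_source hs.smooth h1
    have e2 := contDiffAt_of_source hs'.smooth h2
    have h3 : (fun p => Φ p + Φ' p) = fun p => Φ p + 1 * Φ' p := by funext q; ring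
    rw [solvesAt_iff (e1.add e2), h3, schr_add_const_mul e1 e2,
      (solvesAt_iff e1).1 (hsol p h1), (solvesAt_iff e2).1 (hsol' p h2)]
    simp

/-- The transformation `ψ ↦ ψ + Φ(t, x)` with the domain `U`. -/
noncomputable def shift (U : Set Space) (hU : IsOpen U) (Φ : ℝ × ℝ → ℂ)
    (hΦ : ContinuousOn Φ (Prod.fst '' U)) : LocalTransf where
  toFun z := (z.1, z.2 + Φ z.1)
  invFun z := (z.1, z.2 - Φ z.1)
  source := U
  target := above (Prod.fst '' U) ∩ {z | (z.1, z.2 - Φ z.1) ∈ U}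
  map_source' z hz := ⟨⟨z, hz, rfl⟩, by simpa using hz⟩
  map_target' z hz := hz.2
  left_inv' z _ := by simp
  right_inv' z _ := by simp
  open_source := hU
  open_target := by
    have h : ContinuousOn (fun z : Space => (z.1, z.2 - Φ z.1)) (above (Prod.fst '' U)) :=
      continuousOn_fst.prodMk (continuousOn_snd.sub (hΦ.comp continuousOn_fst fun z hz => hz))
    exact h.isOpen_inter_preimage (isOpen_above (isOpen_image_fst hU)) hU
  continuousOn_toFun := continuousOn_fst.prodMk
    (continuousOn_snd.add (hΦ.comp continuousOn_fst fun z hz => ⟨z, hz, rfl⟩))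
  continuousOn_invFun := continuousOn_fst.prodMk
    (continuousOn_snd.sub (hΦ.comp continuousOn_fst fun z hz => hz.1))

end Shift

/-! ### Conjugation of linear superposition transformations -/

section Conjugation

variable {V V' : Potential} {φ : LocalTransf} {b b' : ℝ × ℝ → ℝ × ℝ} {H K : ℝ × ℝ → ℂ}
  {σ : ℝ × ℝ → ℂ →L[ℝ] ℂ} {p : ℝ × ℝ}

theorem Admissible.solvesAt_linear_iff (hφ : Admissible V V' φ)
    (hd : IsFibreAffine φ b b' H K σ) (hp : p ∈ Prod.fst '' φ.source) {u u' : ℝ × ℝ → ℂ}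
    (hu : ContDiffAt ℝ ∞ u p) (hu' : ContDiffAt ℝ ∞ u' (b p))
    (h : ∀ᶠ q in 𝓝 p, u' (b q) = H q * σ q (u q)) :
    SolvesAt V u p ↔ SolvesAt V' u' (b p) := by
  rw [solvesAt_iff hu, solvesAt_iff hu', hφ.schr_linear_iff hd hp hu hu' h]

theorem Admissible.conjugates (hφ : Admissible V V' φ) (hd : IsFibreAffine φ b b' H K σ) :
    Conjugates φ (linGroup V) (linGroup V') := by
  intro ν'
  constructor
  · rintro ⟨hν', hsrc, htar⟩
    obtain ⟨-, Φ', hs, hsol⟩ := mem_linGroup.1 hν'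
    set ν : LocalTransf := (φ.trans ν').trans φ.symm with hν
    have hmem : ∀ z, z ∈ ν.source ↔ z ∈ φ.source ∧ φ z ∈ ν'.source := by
      intro z
      simp only [hν, OpenPartialHomeomorph.trans_source, Set.mem_inter_iff, Set.mem_preimage,
        OpenPartialHomeomorph.coe_trans, Function.comp_apply, OpenPartialHomeomorph.symm_source]
      exact ⟨fun h => h.1, fun h => ⟨h, htar (ν'.map_source h.2)⟩⟩
    have hb : ∀ p ∈ Prod.fst '' ν.source, p ∈ Prod.fst '' φ.source ∧
        b p ∈ Prod.fst '' ν'.source := by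
      rintro _ ⟨z, hz, rfl⟩
      have h1 := (hmem z).1 hz
      exact ⟨⟨z, h1.1, rfl⟩, ⟨_, h1.2, by rw [hd.apply_eq z h1.1]⟩⟩
    set Φ : ℝ × ℝ → ℂ := fun p => σ p (Φ' (b p) / H p) with hΦ
    have hHΦ : ∀ p ∈ Prod.fst '' φ.source, Φ' (b p) = H p * σ p (Φ p) := by
      intro p hp
      rw [hΦ, hd.σ_σ hp, mul_div_cancel₀ _ (hd.H_ne_zero p hp)]
    have hΦs : ∀ p ∈ Prod.fst '' ν.source, ContDiffAt ℝ ∞ Φ p := by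
      intro p hp
      obtain ⟨h1, h2⟩ := hb p hp
      have e1 : ContDiffAt ℝ ∞ (fun p => Φ' (b p)) p :=
        (contDiffAt_of_source hs.smooth h2).comp p (contDiffAt_of_source hd.smooth_b h1)
      have e2 : ContDiffAt ℝ ∞ (fun p => Φ' (b p) / H p) p := by
        simp only [div_eq_mul_inv]
        exact e1.mul ((contDiffAt_of_source hd.smooth_H h1).inv (hd.H_ne_zero p h1))
      exact (contDiffAt_of_source hd.smooth_σ h1).clm_apply e2
    refine ⟨ν, mem_linGroup.2 ⟨fun z hz => hφ.2.1 ((hmem z).1 hz).1, Φ,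
      ⟨fun p hp => (hΦs p hp).contDiffWithinAt, fun z hz => ?_⟩, fun p hp => ?_⟩, ?_, ?_⟩
    · obtain ⟨h1, h2⟩ := (hmem z).1 hz
      have hp : z.1 ∈ Prod.fst '' φ.source := ⟨z, h1, rfl⟩
      set y := ν z with hy
      have hyφ : y ∈ φ.source := φ.map_target (htar (ν'.map_source h2))
      have e1 : φ y = ν' (φ z) := φ.right_inv (htar (ν'.map_source h2))
      have e2 := hd.apply_eq y hyφ
      rw [e1, hs.apply_eq _ h2, hd.apply_eq z h1] at e2
      have e3 : b z.1 = b y.1 := congrArg Prod.fst e2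
      have e4 : y.1 = z.1 := by
        rw [← hd.left_inv y.1 ⟨y, hyφ, rfl⟩, ← e3, hd.left_inv z.1 hp]
      have e5 : H z.1 * σ z.1 z.2 + K z.1 + Φ' (b z.1) = H y.1 * σ y.1 y.2 + K y.1 :=
        congrArg Prod.snd e2
      rw [e4, hHΦ z.1 hp] at e5
      have e6 : σ z.1 (z.2 + Φ z.1) = σ z.1 y.2 := by
        rw [map_add]
        exact mul_left_cancel₀ (hd.H_ne_zero _ hp) (by linear_combination e5)
      have e7 := congrArg (σ z.1) e6
      rw [hd.σ_σ hp, hd.σ_σ hp] at e7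
      exact Prod.ext e4 e7.symm
    · obtain ⟨h1, h2⟩ := hb p hp
      refine (hφ.solvesAt_linear_iff hd h1 (hΦs p hp) (contDiffAt_of_source hs.smooth h2) ?_).2
        (hsol _ h2)
      filter_upwards [hd.eventually_left_inv h1] with q hq
      exact hHΦ q hq.1
    · ext z
      simp only [OpenPartialHomeomorph.trans_source, Set.mem_inter_iff, Set.mem_preimage,
        OpenPartialHomeomorph.coe_trans, Function.comp_apply, OpenPartialHomeomorph.symm_source,
        hmem]
      constructor
      · intro hz
        have h1 := hsrc hz
        have h2 : φ (φ.symm z) ∈ ν'.source := by rwa [φ.right_inv h1]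
        exact ⟨⟨h1, φ.map_target h1, h2⟩, φ.map_target (htar (ν'.map_source h2))⟩
      · rintro ⟨⟨h1, -, h2⟩, -⟩
        rwa [φ.right_inv h1] at h2
    · intro z hz
      have h1 := hsrc hz
      simp only [hν, OpenPartialHomeomorph.coe_trans, Function.comp_apply]
      rw [φ.right_inv h1, φ.right_inv (htar (ν'.map_source hz))]
  · rintro ⟨ν, hν, hsrc, heq⟩
    obtain ⟨-, Φ, hs, hsol⟩ := mem_linGroup.1 hν
    have hmem : ∀ z, z ∈ ν'.source ↔ (z ∈ φ.target ∧ φ.symm z ∈ ν.source) ∧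
        ν (φ.symm z) ∈ φ.source := by
      intro z
      rw [hsrc]
      simp only [OpenPartialHomeomorph.trans_source, Set.mem_inter_iff, Set.mem_preimage,
        OpenPartialHomeomorph.coe_trans, Function.comp_apply, OpenPartialHomeomorph.symm_source]
    have hval : ∀ z ∈ ν'.source, ν' z = φ (ν (φ.symm z)) := fun z hz => heq hz
    have hsrc' : ν'.source ⊆ φ.target := fun z hz => ((hmem z).1 hz).1.1
    have htar' : ν'.target ⊆ φ.target := by
      intro z hz
      have h1 := ν'.map_target hz
      have h2 := hval _ h1
      rw [ν'.right_inv hz] at h2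
      rw [h2]
      exact φ.map_source ((hmem _).1 h1).2
    have hb : ∀ p ∈ Prod.fst '' ν'.source, b' p ∈ Prod.fst '' φ.source ∧
        b' p ∈ Prod.fst '' ν.source ∧ b (b' p) = p := by
      rintro _ ⟨z, hz, rfl⟩
      have h1 := (hmem z).1 hz
      have h2 := hd.b'_mem (p := z.1) ⟨z, h1.1.1, rfl⟩
      exact ⟨h2.1, ⟨_, h1.1.2, hd.symm_fst h1.1.1⟩, h2.2⟩
    set Φ' : ℝ × ℝ → ℂ := fun p => (fun p => H p * σ p (Φ p)) (b' p) with hΦ'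
    have hΦs : ∀ p ∈ Prod.fst '' ν'.source, ContDiffAt ℝ ∞ Φ' p := by
      intro p hp
      obtain ⟨h1, h2, h3⟩ := hb p hp
      have h4 := hd.contDiffAt_comp_b' h1 ((contDiffAt_of_source hd.smooth_H h1).mul
        ((contDiffAt_of_source hd.smooth_σ h1).clm_apply (contDiffAt_of_source hs.smooth h2)))
      rwa [h3] at h4
    refine ⟨mem_linGroup.2 ⟨fun z hz => hφ.2.2.1 (hsrc' hz), Φ',
      ⟨fun p hp => (hΦs p hp).contDiffWithinAt, fun z hz => ?_⟩, fun p hp => ?_⟩, hsrc', htar'⟩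
    · obtain ⟨⟨h1, h2⟩, h3⟩ := (hmem z).1 hz
      have h4 := hd.apply_eq _ (φ.map_target h1)
      rw [φ.right_inv h1] at h4
      have hp : (φ.symm z).1 ∈ Prod.fst '' φ.source := ⟨_, φ.map_target h1, rfl⟩
      rw [hval z hz, hd.apply_eq _ h3, hs.apply_eq _ h2]
      have h5 : z.1 = b (φ.symm z).1 := congrArg Prod.fst h4
      have h6 : z.2 = H (φ.symm z).1 * σ (φ.symm z).1 (φ.symm z).2 + K (φ.symm z).1 :=
        congrArg Prod.snd h4
      refine Prod.ext h5.symm ?_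
      simp only [hΦ', map_add]
      rw [h6, ← hd.symm_fst h1]
      ring
    · obtain ⟨h1, h2, h3⟩ := hb p hp
      have h4 := (hφ.solvesAt_linear_iff hd h1 (contDiffAt_of_source hs.smooth h2)
        (u' := Φ') (by rw [h3]; exact hΦs p hp) (by
          filter_upwards [hd.eventually_left_inv h1] with q hq
          simp only [hΦ', hq.2])).1 (hsol _ h2)
      rwa [h3] at h4

end Conjugation

/-! ### Equivalence transformations -/

theorem IsSmooth.trans {φ ψ : LocalTransf} (h : IsSmooth φ) (h' : IsSmooth ψ) :
    IsSmooth (φ.trans ψ) := by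
  refine ⟨h'.1.comp (h.1.mono fun z hz => hz.1) fun z hz => hz.2, ?_⟩
  refine h.2.comp (h'.2.mono fun z hz => ?_) fun z hz => ?_
  · rw [OpenPartialHomeomorph.trans_target] at hz; exact hz.1
  · rw [OpenPartialHomeomorph.trans_target] at hz; exact hz.2

section Restriction

variable {V V' : Potential} {φ : LocalTransf} {b b' : ℝ × ℝ → ℝ × ℝ} {H K : ℝ × ℝ → ℂ}
  {σ : ℝ × ℝ → ℂ →L[ℝ] ℂ} {U : Set Space}

theorem restrOpen_target_subset (φ : LocalTransf) (hU : IsOpen U) :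
    (φ.restrOpen U hU).target ⊆ φ.target := fun z hz => by
  have h := (φ.restrOpen U hU).map_target hz
  rw [OpenPartialHomeomorph.restrOpen_source] at h
  have h1 := φ.map_source h.1
  have h2 : φ ((φ.restrOpen U hU).symm z) = z := (φ.restrOpen U hU).right_inv hz
  rwa [h2] at h1

theorem IsSmooth.restrOpen (h : IsSmooth φ) (hU : IsOpen U) : IsSmooth (φ.restrOpen U hU) :=
  ⟨h.1.mono fun _ hz => hz.1, h.2.mono (restrOpen_target_subset φ hU)⟩

theorem Admissible.restrOpen (hφ : Admissible V V' φ) (hU : IsOpen U) :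
    Admissible V V' (φ.restrOpen U hU) :=
  ⟨hφ.1.restrOpen hU, fun _ hz => hφ.2.1 hz.1,
    fun _ hz => hφ.2.2.1 (restrOpen_target_subset φ hU hz),
    fun u u' p p' hu hu' hm => hφ.2.2.2 u u' p p' hu hu' ⟨hm.1.1, hm.2⟩⟩

theorem IsFibreAffine.restrOpen (hd : IsFibreAffine φ b b' H K σ) (hU : IsOpen U) :
    IsFibreAffine (φ.restrOpen U hU) b b' H K σ := by
  have hs : Prod.fst '' (φ.restrOpen U hU).source ⊆ Prod.fst '' φ.source :=
    Set.image_mono fun _ hz => hz.1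
  exact ⟨hd.smooth_b.mono hs, hd.smooth_b'.mono (Set.image_mono (restrOpen_target_subset φ hU)),
    hd.smooth_H.mono hs, hd.smooth_K.mono hs, hd.smooth_σ.mono hs,
    fun z hz => hd.apply_eq z hz.1, fun p hp => hd.left_inv p (hs hp),
    fun p hp => hd.H_ne_zero p (hs hp), fun p hp => hd.σ_eq p (hs hp)⟩

theorem IsFibreAffine.fibreConvex_target (hd : IsFibreAffine φ b b' H K σ)
    (hc : FibreConvex φ.source) : FibreConvex φ.target := by
  intro p ψ hψ ψ' hψ' r s hr hs hrs
  have h1 := φ.map_target hψ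
  have h2 := φ.map_target hψ'
  have e1 : φ.symm (p, ψ) = (b' p, (φ.symm (p, ψ)).2) := Prod.ext (hd.symm_fst hψ) rfl
  have e2 : φ.symm (p, ψ') = (b' p, (φ.symm (p, ψ')).2) := Prod.ext (hd.symm_fst hψ') rfl
  have f1 := φ.right_inv hψ
  have f2 := φ.right_inv hψ'
  set x := (φ.symm (p, ψ)).2
  set y := (φ.symm (p, ψ')).2
  rw [e1] at h1 f1
  rw [e2] at h2 f2
  rw [hd.apply_eq _ h1] at f1
  rw [hd.apply_eq _ h2] at f2
  have h3 : (b' p, r • x + s • y) ∈ φ.source := hc (b' p) h1 h2 hr hs hrs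
  have h4 := φ.map_source h3
  rw [hd.apply_eq _ h3] at h4
  have g0 : b (b' p) = p := congrArg Prod.fst f1
  have g1 : H (b' p) * σ (b' p) x + K (b' p) = ψ := congrArg Prod.snd f1
  have g2 : H (b' p) * σ (b' p) y + K (b' p) = ψ' := congrArg Prod.snd f2
  have hrs' : (r : ℂ) + s = 1 := by exact_mod_cast hrs
  have h5 : H (b' p) * σ (b' p) (r • x + s • y) + K (b' p) = r • ψ + s • ψ' := by
    rw [map_add, map_smul, map_smul, ← g1, ← g2]
    simp only [Complex.real_smul]
    linear_combination (-K (b' p)) * hrs'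
  simp only [g0, h5] at h4
  exact h4

end Restriction

section Extension

variable {V V' W : Potential} {χ : LocalTransf} {b b' : ℝ × ℝ → ℝ × ℝ} {H : ℝ × ℝ → ℂ}
  {σ : ℝ × ℝ → ℂ →L[ℝ] ℂ} {p : ℝ × ℝ}

theorem Potential.contDiffAt (V : Potential) (hp : p ∈ V.dom) : ContDiffAt ℝ ∞ V.val p :=
  V.smooth.contDiffAt (V.isOpen_dom.mem_nhds hp)

theorem Admissible.mem_dom (hφ : Admissible V V' χ) (hp : p ∈ Prod.fst '' χ.source) :
    p ∈ V.dom := by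
  obtain ⟨z, hz, rfl⟩ := hp; exact hφ.2.1 hz

theorem Admissible.mem_dom' (hφ : Admissible V V' χ) (hp : p ∈ Prod.fst '' χ.target) :
    p ∈ V'.dom := by
  obtain ⟨z, hz, rfl⟩ := hp; exact hφ.2.2.1 hz

theorem IsFibreAffine.contDiffAt_rate {K : ℝ × ℝ → ℂ} (hd : IsFibreAffine χ b b' H K σ)
    (hp : p ∈ Prod.fst '' χ.source) : ContDiffAt ℝ ∞ (fun p => (rate b b' p : ℂ)) p := by
  have h1 : ContDiffAt ℝ ∞ (fderiv ℝ b') (b p) :=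
    (hd.contDiffAt_b' hp).fderiv_right (by norm_cast)
  have h2 : ContDiffAt ℝ ∞ (fun p => fderiv ℝ b' (b p)) p :=
    h1.comp p (contDiffAt_of_source hd.smooth_b hp)
  have h3 : ContDiffAt ℝ ∞ (fun p => fderiv ℝ b' (b p) (0, 1)) p :=
    h2.clm_apply contDiffAt_const
  have h4 : ContDiffAt ℝ ∞ (fun p => (fderiv ℝ b' (b p) (0, 1)).2) p := contDiffAt_snd.comp p h3
  exact Complex.ofRealCLM.contDiff.contDiffAt.comp p (h4.pow 2)

/-- The value at `b p` of the transformed potential, if the original potential has the value `v`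
at `p`. -/
noncomputable def potVal (V V' : Potential) (b b' : ℝ × ℝ → ℝ × ℝ) (σ : ℝ × ℝ → ℂ →L[ℝ] ℂ)
    (p : ℝ × ℝ) (v : ℂ) : ℂ := V'.val (b p) + rate b b' p * σ p (v - V.val p)

/-- The inverse of `potVal`, as a function of the point `p' = b p`. -/
noncomputable def potVal' (V V' : Potential) (b b' : ℝ × ℝ → ℝ × ℝ) (σ : ℝ × ℝ → ℂ →L[ℝ] ℂ)
    (p' : ℝ × ℝ) (v : ℂ) : ℂ :=
  V.val (b' p') + σ (b' p') ((v - V'.val p') * (rate b b' (b' p') : ℂ)⁻¹)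

theorem potVal'_potVal (hφ : Admissible V V' χ)
    (hd : IsFibreAffine χ b b' H (fun _ => 0) σ) (hp : p ∈ Prod.fst '' χ.source) (v : ℂ) :
    potVal' V V' b b' σ (b p) (potVal V V' b b' σ p v) = v := by
  have h : (rate b b' p : ℂ) ≠ 0 := by exact_mod_cast hφ.rate_ne_zero hd hp
  simp only [potVal', potVal, hd.left_inv p hp]
  rw [add_sub_cancel_left, mul_comm, inv_mul_cancel_left₀ h, hd.σ_σ hp, add_sub_cancel]

theorem potVal_potVal' (hφ : Admissible V V' χ)
    (hd : IsFibreAffine χ b b' H (fun _ => 0) σ) (hp : p ∈ Prod.fst '' χ.target) (v : ℂ) :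
    potVal V V' b b' σ (b' p) (potVal' V V' b b' σ p v) = v := by
  obtain ⟨h1, h2⟩ := hd.b'_mem hp
  have h : (rate b b' (b' p) : ℂ) ≠ 0 := by exact_mod_cast hφ.rate_ne_zero hd h1
  simp only [potVal', potVal, h2]
  rw [add_sub_cancel_left, hd.σ_σ h1, mul_comm, inv_mul_cancel_right₀ h, add_sub_cancel]

theorem contDiffAt_potVal (hφ : Admissible V V' χ)
    (hd : IsFibreAffine χ b b' H (fun _ => 0) σ)
    {E : Type*} [NormedAddCommGroup E] [NormedSpace ℝ E]
    {f : E → ℝ × ℝ} {g : E → ℂ} {x : E} (hp : f x ∈ Prod.fst '' χ.source)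
    (hf : ContDiffAt ℝ ∞ f x) (hg : ContDiffAt ℝ ∞ g x) :
    ContDiffAt ℝ ∞ (fun y => potVal V V' b b' σ (f y) (g y)) x := by
  have h1 : ContDiffAt ℝ ∞ (fun p => V'.val (b p)) (f x) :=
    (V'.contDiffAt (hφ.mem_dom' (hd.b_mem hp))).comp (f x) (contDiffAt_of_source hd.smooth_b hp)
  have h2 := V.contDiffAt (hφ.mem_dom hp)
  exact (h1.comp x hf).add (((hd.contDiffAt_rate hp).comp x hf).mul
    (((contDiffAt_of_source hd.smooth_σ hp).comp x hf).clm_apply (hg.sub (h2.comp x hf))))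

theorem contDiffAt_potVal' (hφ : Admissible V V' χ)
    (hd : IsFibreAffine χ b b' H (fun _ => 0) σ)
    {E : Type*} [NormedAddCommGroup E] [NormedSpace ℝ E]
    {f : E → ℝ × ℝ} {g : E → ℂ} {x : E} (hp : f x ∈ Prod.fst '' χ.target)
    (hf : ContDiffAt ℝ ∞ f x) (hg : ContDiffAt ℝ ∞ g x) :
    ContDiffAt ℝ ∞ (fun y => potVal' V V' b b' σ (f y) (g y)) x := by
  obtain ⟨h1, h2⟩ := hd.b'_mem hp
  have hb : ContDiffAt ℝ ∞ b' (f x) :=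
    hd.smooth_b'.contDiffAt ((isOpen_image_fst χ.open_target).mem_nhds hp)
  have hr : (rate b b' (b' (f x)) : ℂ) ≠ 0 := by exact_mod_cast hφ.rate_ne_zero hd h1
  have hbf : ContDiffAt ℝ ∞ (fun y => b' (f y)) x := hb.comp x hf
  have e1 : ContDiffAt ℝ ∞ (fun y => V.val (b' (f y))) x :=
    (V.contDiffAt (hφ.mem_dom h1)).comp x hbf
  have e2 : ContDiffAt ℝ ∞ (fun y => V'.val (f y)) x := (V'.contDiffAt (hφ.mem_dom' hp)).comp x hf
  have e3 : ContDiffAt ℝ ∞ (fun y => (rate b b' (b' (f y)) : ℂ)) x :=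
    (hd.contDiffAt_rate h1).comp x hbf
  have e4 : ContDiffAt ℝ ∞ (fun y => σ (b' (f y))) x :=
    (contDiffAt_of_source hd.smooth_σ h1).comp x hbf
  exact e1.add (e4.clm_apply ((hg.sub e2).mul (e3.inv hr)))

/-- The image of the potential `W`. -/
noncomputable def imagePotential (hφ : Admissible V V' χ)
    (hd : IsFibreAffine χ b b' H (fun _ => 0) σ) (W : Potential) : Potential where
  dom := Prod.fst '' χ.target ∩ b' ⁻¹' W.dom
  isOpen_dom := hd.smooth_b'.continuousOn.isOpen_inter_preimage
    (isOpen_image_fst χ.open_target) W.isOpen_dom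
  val p := potVal V V' b b' σ (b' p) (W.val (b' p))
  smooth p hp := by
    have hb : ContDiffAt ℝ ∞ b' p :=
      hd.smooth_b'.contDiffAt ((isOpen_image_fst χ.open_target).mem_nhds hp.1)
    exact (contDiffAt_potVal hφ hd (hd.b'_mem hp.1).1 hb
      ((W.contDiffAt hp.2).comp p hb)).contDiffWithinAt

theorem admissible_image (hφ : Admissible V V' χ) (hd : IsFibreAffine χ b b' H (fun _ => 0) σ)
    (W : Potential) : Admissible W (imagePotential hφ hd W)
      (χ.restrOpen (above W.dom) (isOpen_above W.isOpen_dom)) := by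
  refine ⟨hφ.1.restrOpen _, fun z hz => hz.2, fun z hz => ?_, ?_⟩
  · have h1 := restrOpen_target_subset _ _ hz
    have h2 := ((χ.restrOpen (above W.dom) (isOpen_above W.isOpen_dom)).map_target hz).2
    refine ⟨⟨z, h1, rfl⟩, ?_⟩
    rw [Set.mem_preimage, ← hd.symm_fst h1]
    exact h2
  · intro u u' p p' hu hu' hm
    obtain ⟨rfl, hev⟩ := (hd.restrOpen (isOpen_above W.isOpen_dom)).of_mapsGraphAt hu hm
    have hp : p ∈ Prod.fst '' χ.source := ⟨_, hm.1.1, rfl⟩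
    simp only [add_zero] at hev
    have h1 := hφ.schr_linear hd hp hu hu' hev
    have h2 := hev.self_of_nhds
    have h3 : schr (imagePotential hφ hd W) u' (b p) =
        H p * rate b b' p * σ p (schr W u p) := by
      have e1 : schr (imagePotential hφ hd W) u' (b p) = schr V' u' (b p) +
          ((imagePotential hφ hd W).val (b p) - V'.val (b p)) * u' (b p) := by
        simp only [schr]; ring
      have e2 : schr W u p = schr V u p + (W.val p - V.val p) * u p := by
        simp only [schr]; ring
      have e3 : (imagePotential hφ hd W).val (b p) = potVal V V' b b' σ p (W.val p) := by
        simp only [imagePotential, hd.left_inv p hp]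
      rw [e1, e2, e3, h1, h2, potVal, map_add, hd.σ_mul hp]
      ring
    have hr : (rate b b' p : ℂ) ≠ 0 := by exact_mod_cast hφ.rate_ne_zero hd hp
    rw [solvesAt_iff hu, solvesAt_iff hu', h3]
    constructor
    · intro h; rw [h, map_zero, mul_zero]
    · intro h
      have h4 := (mul_eq_zero.1 h).resolve_left (mul_ne_zero (hd.H_ne_zero p hp) hr)
      rw [← hd.σ_σ hp (schr W u p), h4, map_zero]

/-- An admissible transformation without an inhomogeneous part extends to an equivalence
transformation. -/
theorem exists_mem_equivGroup (hφ : Admissible V V' χ)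
    (hd : IsFibreAffine χ b b' H (fun _ => 0) σ) (hc : FibreConvex χ.source) :
    ∃ T ∈ equivGroup, T.proj = χ ∧ T.Sends V V' := by
  have hf : ContDiffOn ℝ ∞ (fun w : Space × ℂ => (χ w.1, potVal V V' b b' σ w.1.1 w.2))
      (χ.source ×ˢ Set.univ) := by
    intro w hw
    have h1 : ContDiffAt ℝ ∞ (fun w : Space × ℂ => χ w.1) w :=
      (hφ.1.contDiffAt hw.1).comp w contDiffAt_fst
    exact (h1.prodMk (contDiffAt_potVal hφ hd ⟨_, hw.1, rfl⟩
      (contDiffAt_fst.comp w contDiffAt_fst) contDiffAt_snd)).contDiffWithinAt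
  have hg : ContDiffOn ℝ ∞ (fun w : Space × ℂ => (χ.symm w.1, potVal' V V' b b' σ w.1.1 w.2))
      (χ.target ×ˢ Set.univ) := by
    intro w hw
    have h1 : ContDiffAt ℝ ∞ (fun w : Space × ℂ => χ.symm w.1) w :=
      (hφ.1.symm.contDiffAt hw.1).comp w contDiffAt_fst
    exact (h1.prodMk (contDiffAt_potVal' hφ hd ⟨_, hw.1, rfl⟩
      (contDiffAt_fst.comp w contDiffAt_fst) contDiffAt_snd)).contDiffWithinAt
  let e : OpenPartialHomeomorph (Space × ℂ) (Space × ℂ) :=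
    { toFun := fun w => (χ w.1, potVal V V' b b' σ w.1.1 w.2)
      invFun := fun w => (χ.symm w.1, potVal' V V' b b' σ w.1.1 w.2)
      source := χ.source ×ˢ Set.univ
      target := χ.target ×ˢ Set.univ
      map_source' := fun w hw => ⟨χ.map_source hw.1, trivial⟩
      map_target' := fun w hw => ⟨χ.map_target hw.1, trivial⟩
      left_inv' := fun w hw => by
        have h1 : (χ w.1).1 = b w.1.1 := by rw [hd.apply_eq _ hw.1]
        refine Prod.ext (χ.left_inv hw.1) ?_
        simp only [h1]
        exact potVal'_potVal hφ hd ⟨_, hw.1, rfl⟩ _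
      right_inv' := fun w hw => by
        refine Prod.ext (χ.right_inv hw.1) ?_
        simp only [hd.symm_fst hw.1]
        exact potVal_potVal' hφ hd ⟨_, hw.1, rfl⟩ _
      open_source := χ.open_source.prod isOpen_univ
      open_target := χ.open_target.prod isOpen_univ
      continuousOn_toFun := hf.continuousOn
      continuousOn_invFun := hg.continuousOn }
  let T : ProjectableTransf :=
    { ext := e
      proj := χ
      smooth := ⟨hf, hg⟩
      ext_source := rfl
      ext_target := rfl
      ext_fst := fun _ _ => rfl
      fibre_source := hc
      fibre_target := hd.fibreConvex_target hc }
  refine ⟨T, fun W => ⟨imagePotential hφ hd W, fun z hz => ?_, admissible_image hφ hd W⟩, rfl,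
    fun z hz => ?_, hφ.restrOpen _⟩
  · have hz1 : z ∈ χ.source := hz.1
    have hb : (χ z).1 = b z.1 := by rw [hd.apply_eq _ hz1]
    change potVal V V' b b' σ (b' (χ z).1) (W.val (b' (χ z).1)) =
      potVal V V' b b' σ z.1 (W.val z.1)
    rw [hb, hd.left_inv _ ⟨z, hz1, rfl⟩]
  · have hz1 : z ∈ χ.source := hz.1
    have hb : (χ z).1 = b z.1 := by rw [hd.apply_eq _ hz1]
    change V'.val (χ z).1 = potVal V V' b b' σ z.1 (V.val z.1)
    rw [hb, potVal, sub_self, map_zero, mul_zero, add_zero]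

end Extension

/-! ### Factorization of admissible transformations -/

section Factorization

variable {V V' : Potential} {φ : LocalTransf} {b b' : ℝ × ℝ → ℝ × ℝ} {H K : ℝ × ℝ → ℂ}
  {σ : ℝ × ℝ → ℂ →L[ℝ] ℂ} {p : ℝ × ℝ}

/-- The inhomogeneous part of an admissible transformation comes from a solution of the original
equation: it is the difference between the preimage of a solution under the linear part and under
the transformation itself. -/
theorem Admissible.solvesAt_shift (hφ : Admissible V V' φ) (hd : IsFibreAffine φ b b' H K σ)
    (hp : p ∈ Prod.fst '' φ.source) :
    ContDiffAt ℝ ∞ (fun p => σ p (K p / H p)) p ∧ SolvesAt V (fun p => σ p (K p / H p)) p := by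
  have hΦ : ContDiffAt ℝ ∞ (fun p => σ p (K p / H p)) p := by
    have e2 : ContDiffAt ℝ ∞ (fun p => K p / H p) p := by
      simp only [div_eq_mul_inv]
      exact (contDiffAt_of_source hd.smooth_K hp).mul
        ((contDiffAt_of_source hd.smooth_H hp).inv (hd.H_ne_zero p hp))
    exact (contDiffAt_of_source hd.smooth_σ hp).clm_apply e2
  refine ⟨hΦ, ?_⟩
  obtain ⟨u₀, u₀', hu₀s, hu₀s', -, hev₀, hs₀, hs₀'⟩ := hφ.exists_solution hd hp
  have h1 := (hφ.schr_linear_iff hd hp (u := fun q => u₀ q + 1 * σ q (K q / H q))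
    (hu₀s.add (contDiffAt_const.mul hΦ)) hu₀s' (by
      filter_upwards [hev₀, hd.eventually_left_inv hp] with q h2 h3
      rw [h2, one_mul, map_add, hd.σ_σ h3.1, mul_add, mul_div_cancel₀ _ (hd.H_ne_zero q h3.1)])).2
    hs₀'
  rw [schr_add_const_mul hu₀s hΦ, hs₀, zero_add, one_mul] at h1
  exact (solvesAt_iff hΦ).2 h1

theorem Admissible.exists_factorization (hφ : Admissible V V' φ)
    (hd : IsFibreAffine φ b b' H K σ) (hc : FibreConvex φ.source) :
    ∃ ν ∈ linGroup V, ∃ T ∈ equivGroup, T.Sends V V' ∧ φ ≈ ν.trans T.proj ∧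
      T.proj.target = φ.target := by
  set Φ : ℝ × ℝ → ℂ := fun p => σ p (K p / H p) with hΦ
  have hΦs : ContDiffOn ℝ ∞ Φ (Prod.fst '' φ.source) := fun p hp =>
    (hφ.solvesAt_shift hd hp).1.contDiffWithinAt
  set ν := shift φ.source φ.open_source Φ hΦs.continuousOn with hν
  have hνs : IsShift ν Φ := ⟨hΦs, fun _ _ => rfl⟩
  have hνsrc : ν.source = φ.source := rfl
  have hνmem : ν ∈ linGroup V := mem_linGroup.2 ⟨hφ.2.1, Φ, hνs, fun p hp =>
    (hφ.solvesAt_shift hd hp).2⟩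
  set χ : LocalTransf := ν.symm.trans φ with hχ
  have hχmem : ∀ z, z ∈ χ.source ↔ z ∈ ν.target := fun z =>
    ⟨fun hz => hz.1, fun hz => ⟨hz, ν.map_target hz⟩⟩
  have hχsrc : χ.source = ν.target := Set.ext hχmem
  have hχtar : χ.target = φ.target := by
    rw [hχ, OpenPartialHomeomorph.trans_target]
    exact Set.inter_eq_left.2 fun z hz => φ.map_target hz
  have hχs : Prod.fst '' χ.source = Prod.fst '' φ.source := by
    rw [hχsrc, hνs.image_target, hνsrc]
  have hχd : IsFibreAffine χ b b' H (fun _ => 0) σ := by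
    refine ⟨by rw [hχs]; exact hd.smooth_b, by rw [hχtar]; exact hd.smooth_b',
      by rw [hχs]; exact hd.smooth_H, contDiffOn_const, by rw [hχs]; exact hd.smooth_σ, ?_,
      by rw [hχs]; exact hd.left_inv, by rw [hχs]; exact hd.H_ne_zero,
      by rw [hχs]; exact hd.σ_eq⟩
    intro z hz
    have hz' := (hχmem z).1 hz
    have hzφ : ν.symm z ∈ φ.source := ν.map_target hz'
    have hp : z.1 ∈ Prod.fst '' φ.source := hχs ▸ ⟨z, hz, rfl⟩
    have h1 : χ z = φ (ν.symm z) := rfl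
    rw [h1, hd.apply_eq _ hzφ, hνs.symm_apply hz', map_sub, hΦ]
    simp only
    rw [hd.σ_σ hp, mul_sub, mul_div_cancel₀ _ (hd.H_ne_zero _ hp)]
    simp
  have hχa : Admissible V V' χ := by
    refine ⟨hνs.symm.isSmooth.trans hφ.1, fun z hz => ?_, ?_, ?_⟩
    · exact (linGroup_subset_symGroup V hνmem).2.2.1 ((hχmem z).1 hz)
    · rw [hχtar]; exact hφ.2.2.1
    · intro u u' p p' hu hu' hm
      obtain ⟨rfl, hev⟩ := hχd.of_mapsGraphAt hu hm
      simp only [add_zero] at hev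
      exact hφ.solvesAt_linear_iff hd (hχs ▸ ⟨_, hm.1, rfl⟩) hu hu' hev
  have hχc : FibreConvex χ.source := by
    have hν0 : FibreConvex ν.target := by
      refine IsFibreAffine.fibreConvex_target (b := id) (b' := id) (H := fun _ => 1) (K := Φ)
        (σ := fun _ => ContinuousLinearMap.id ℝ ℂ) ?_ hc
      exact ⟨contDiffOn_id, contDiffOn_id, contDiffOn_const, hΦs, contDiffOn_const,
        fun z _ => by simp [hν, shift], fun _ _ => rfl, fun _ _ => one_ne_zero,
        fun _ _ => Or.inl rfl⟩
    rwa [hχsrc]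
  obtain ⟨T, hT, hTχ, hTV⟩ := exists_mem_equivGroup hχa hχd hχc
  refine ⟨ν, hνmem, T, hT, hTV, ?_, by rw [hTχ, hχtar]⟩
  rw [hTχ]
  refine ⟨?_, ?_⟩
  · rw [OpenPartialHomeomorph.trans_source, hχsrc]
    exact (Set.inter_eq_left.2 fun z hz => ν.map_source hz).symm
  · intro z hz
    have h1 : (ν.trans χ) z = φ (ν.symm (ν z)) := rfl
    rw [h1, ν.left_inv hz]

/-- Near each point of its domain an admissible transformation has the affine form. -/
theorem Admissible.exists_local (hφ : Admissible V V' φ) {z : Space} (hz : z ∈ φ.source) :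
    ∃ (U : Set Space) (hU : IsOpen U), z ∈ U ∧ U ⊆ φ.source ∧
      FibreConvex (φ.restrOpen U hU).source ∧
      ∃ b b' H K σ, IsFibreAffine (φ.restrOpen U hU) b b' H K σ := by
  -- balls have convex fibres; on a ball around the image point, the inverse respects the fibres
  have hbox : ∀ (S : Set Space), IsOpen S → ∀ y ∈ S, ∃ B : Set Space, IsOpen B ∧ y ∈ B ∧ B ⊆ S ∧
      FibreConvex B := by
    intro S hS y hy
    obtain ⟨r, hr, hrS⟩ := Metric.isOpen_iff.1 hS y hy
    refine ⟨Metric.ball y r, Metric.isOpen_ball, Metric.mem_ball_self hr, hrS, ?_⟩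
    intro p ψ hψ ψ' hψ' s t hs ht hst
    have := (convex_ball y r) hψ hψ' hs ht hst
    have h2 : s • ((p, ψ) : Space) + t • ((p, ψ') : Space) = (p, s • ψ + t • ψ') := by
      refine Prod.ext ?_ rfl
      change s • p + t • p = p
      rw [← add_smul, hst, one_smul]
    rwa [h2] at this
  obtain ⟨B', hB'o, hzB', hB't, hB'c⟩ := hbox φ.target φ.open_target _ (φ.map_source hz)
  have hpre : IsOpen (φ.source ∩ φ ⁻¹' B') :=
    φ.continuousOn.isOpen_inter_preimage φ.open_source hB'o
  obtain ⟨U, hUo, hzU, hUs, hUc⟩ := hbox _ hpre z ⟨hz, hzB'⟩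
  have hc : FibreConvex (φ.restrOpen U hUo).source := by
    have : (φ.restrOpen U hUo).source = U := by
      rw [OpenPartialHomeomorph.restrOpen_source]
      exact Set.inter_eq_right.2 fun y hy => (hUs hy).1
    rwa [this]
  have htar : (φ.restrOpen U hUo).target ⊆ B' := by
    intro y hy
    have h1 := (hUs ((φ.restrOpen U hUo).map_target hy).2).2
    have h2 : φ ((φ.restrOpen U hUo).symm y) = y := (φ.restrOpen U hUo).right_inv hy
    rw [Set.mem_preimage, h2] at h1
    exact h1
  set ρ := φ.symm.restrOpen B' hB'o with hρ
  have hρsrc : ρ.source = B' := by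
    rw [hρ, OpenPartialHomeomorph.restrOpen_source]
    exact Set.inter_eq_right.2 hB't
  obtain ⟨b', hb's, hb'⟩ := exists_base (φ := ρ) (hφ.1.symm.restrOpen hB'o)
    (fun y hy w => hφ.fderiv_symm_vert hy.1 w) (by rwa [hρsrc])
  rw [hρsrc] at hb's hb'
  obtain ⟨b, H, K, σ, hd⟩ := (hφ.restrOpen hUo).exists_isFibreAffine hc
    (hb's.mono (Set.image_mono htar)) fun y hy => hb' y (htar hy)
  exact ⟨U, hUo, hzU, fun y hy => (hUs hy).1, hc, b, b', H, K, σ, hd⟩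

theorem Admissible.exists_global (hφ : Admissible V V' φ) (hc : FibreConvex φ.source)
    (hc' : FibreConvex φ.target) : ∃ b b' H K σ, IsFibreAffine φ b b' H K σ := by
  obtain ⟨b', hb's, hb'⟩ := exists_base (φ := φ.symm) hφ.1.symm
    (fun y hy w => hφ.fderiv_symm_vert hy w) hc'
  obtain ⟨b, H, K, σ, hd⟩ := hφ.exists_isFibreAffine hc hb's hb'
  exact ⟨b, b', H, K, σ, hd⟩

end Factorization

/-! ### Semi-normalization of the class -/

/-- The potential with the constant value `c`. -/
def constPotential (c : ℂ) : Potential where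
  dom := Set.univ
  isOpen_dom := isOpen_univ
  val _ := c
  smooth := contDiffOn_const

theorem on_constPotential_source (T : ProjectableTransf) (c : ℂ) :
    (T.on (constPotential c)).source = T.proj.source := by
  refine Set.inter_eq_left.2 fun z _ => ?_
  exact Set.mem_univ z.1

theorem exists_isFibreAffine_of_mem_equivGroup {T : ProjectableTransf} (hT : T ∈ equivGroup) :
    ∃ b b' H K σ, IsFibreAffine T.proj b b' H K σ := by
  obtain ⟨V', -, hV'⟩ := hT (constPotential 0)
  have hs := on_constPotential_source T 0
  have ht : (T.on (constPotential 0)).target = T.proj.target := by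
    refine Set.Subset.antisymm (restrOpen_target_subset _ _) fun z hz => ?_
    have h1 : T.proj (T.proj.symm z) = z := T.proj.right_inv hz
    have h2 : T.proj.symm z ∈ (T.on (constPotential 0)).source := hs ▸ T.proj.map_target hz
    have h3 := (T.on (constPotential 0)).map_source h2
    change T.proj (T.proj.symm z) ∈ _ at h3
    rwa [h1] at h3
  obtain ⟨b, b', H, K, σ, hd⟩ := hV'.exists_global (by rw [hs]; exact T.fibre_source)
    (by rw [ht]; exact T.fibre_target)
  refine ⟨b, b', H, K, σ, ?_⟩
  obtain ⟨h1, h2, h3, h4, h5, h6, h7, h8, h9⟩ := hd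
  rw [hs] at h1 h3 h4 h5 h6 h7 h8 h9
  rw [ht] at h2
  exact ⟨h1, h2, h3, h4, h5, h6, h7, h8, h9⟩

/-- If a translation `ψ ↦ ψ + Φ` maps the equation with the constant potential `c` to the equation
with the potential `V'`, then `V' = c` and `Φ` solves this equation. -/
theorem Admissible.shift_constPotential {V' : Potential} {φ : LocalTransf} {Φ : ℝ × ℝ → ℂ}
    {c : ℂ} (hφ : Admissible (constPotential c) V' φ) (hs : IsShift φ Φ) {p : ℝ × ℝ}
    (hp : p ∈ Prod.fst '' φ.source) :
    V'.val p = c ∧ schr (constPotential c) Φ p = 0 := by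
  obtain ⟨⟨p₁, ψ⟩, hz, rfl : p₁ = p⟩ := id hp
  have hΦ := contDiffAt_of_source hs.smooth hp
  have key : ∀ x : ℂ, (p₁, x) ∈ φ.source → (V'.val p₁ - c) * x + schr V' Φ p₁ = 0 := by
    intro x hx
    set u := testFun p₁ x 0 0 (-(c * x)) 0 with hu
    have hus : ContDiffAt ℝ ∞ u p₁ := (contDiff_testFun _ _ _ _ _ _).contDiffAt
    have hzu : (p₁, u p₁) ∈ φ.source := by simpa [hu] using hx
    have hφu : (φ (p₁, u p₁)).1 = p₁ := by rw [hs.apply_eq _ hzu]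
    have himg : IsImage φ u (fun q => u q + 1 * Φ q) p₁ := by
      refine ⟨hus, by rw [hφu]; exact hus.add (contDiffAt_const.mul hΦ), hzu, rfl, ?_⟩
      have hcont : ContinuousAt (fun q : ℝ × ℝ => ((q, u q) : Space)) p₁ :=
        continuousAt_id.prodMk hus.continuousAt
      filter_upwards [hcont.preimage_mem_nhds (φ.open_source.mem_nhds hzu)] with q hq
      rw [hs.apply_eq _ hq]
      simp
    have h1 := (hφ.schr_iff himg).1 (by
      rw [hu, schr_testFun]; simp [constPotential])
    rw [hφu, schr_add_const_mul hus hΦ, hu, schr_testFun] at h1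
    linear_combination h1
  -- the relation holds for two values of `ψ`
  obtain ⟨δ, hδ0, hδ⟩ := exists_real_ne_zero_mem φ.open_source hz 1
  have h1 := key _ hz
  have h2 := key _ hδ
  have hδ0' : (δ : ℂ) ≠ 0 := by exact_mod_cast hδ0
  have h3 : (V'.val p₁ - c) * δ = 0 := by linear_combination h2 - h1
  have h4 : V'.val p₁ = c := sub_eq_zero.1 ((mul_eq_zero.1 h3).resolve_right hδ0')
  refine ⟨h4, ?_⟩
  rw [h4, sub_self, zero_mul, zero_add] at h1
  have h5 : schr (constPotential c) Φ p₁ = schr V' Φ p₁ := by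
    simp only [schr, constPotential, h4]
  rw [h5, h1]

/-- An equivalence transformation of the form `ψ ↦ ψ + Φ` is the identity, since `Φ` solves the
equations with all constant potentials. -/
theorem eq_id_of_mem_linGroup {V : Potential} {T : ProjectableTransf} (hT : T ∈ equivGroup)
    (hV : T.proj ∈ linGroup V) : ∀ w ∈ T.ext.source, T.ext w = w := by
  obtain ⟨-, Φ, hs, -⟩ := mem_linGroup.1 hV
  have key : ∀ (c : ℂ) (z : Space), z ∈ T.proj.source →
      (T.ext (z, c)).2 = c ∧ schr (constPotential c) Φ z.1 = 0 := by
    intro c z hz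
    obtain ⟨V', hV', hadm⟩ := hT (constPotential c)
    have hsrc := on_constPotential_source T c
    have hs' : IsShift (T.on (constPotential c)) Φ :=
      ⟨by rw [hsrc]; exact hs.smooth, fun z hz => hs.apply_eq z (hsrc ▸ hz)⟩
    have hz' : z ∈ (T.on (constPotential c)).source := by rwa [hsrc]
    obtain ⟨h1, h2⟩ := hadm.shift_constPotential hs' ⟨z, hz', rfl⟩
    have h3 := hV' z hz'
    rw [hs.apply_eq z hz] at h3
    exact ⟨h3.symm.trans h1, h2⟩
  intro w hw
  have hz : w.1 ∈ T.proj.source := by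
    rw [T.ext_source] at hw; exact hw.1
  have h0 := (key 0 w.1 hz).2
  have h1 := (key 1 w.1 hz).2
  simp only [schr, constPotential] at h0 h1
  have hΦ : Φ w.1.1 = 0 := by linear_combination h1 - h0
  refine Prod.ext ?_ (key w.2 w.1 hz).1
  rw [T.ext_fst w hw, hs.apply_eq _ hz, hΦ, add_zero]

theorem linGroup_uniformlySemiNormalized : UniformlySemiNormalized linGroup where
  isSymSubgroup := linGroup_isSymSubgroup
  eq_id _ _ hT hV := eq_id_of_mem_linGroup hT hV
  equivariant V V' T hT hTV := by
    obtain ⟨b, b', H, K, σ, hd⟩ := exists_isFibreAffine_of_mem_equivGroup hT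
    exact hTV.2.conjugates (hd.restrOpen (isOpen_above V.isOpen_dom))
  factorization V V' φ hφ z hz := by
    obtain ⟨U, hU, hzU, hUs, hc, b, b', H, K, σ, hd⟩ := hφ.exists_local hz
    obtain ⟨ν, hν, T, hT, hTV, heq, htar⟩ := (hφ.restrOpen hU).exists_factorization hd hc
    refine ⟨U, hU, hzU, hUs, ν, hν, OpenPartialHomeomorph.ofSet T.proj.target T.proj.open_target,
      ofSet_mem_linGroup V' _ ?_, T, hT, hTV, ?_⟩
    · rw [htar]; exact (hφ.restrOpen hU).2.2.1
    · refine Setoid.trans heq ⟨?_, fun z _ => rfl⟩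
      ext y
      simp only [OpenPartialHomeomorph.trans_source, Set.mem_inter_iff, Set.mem_preimage,
        OpenPartialHomeomorph.coe_trans, Function.comp_apply,
        OpenPartialHomeomorph.ofSet_source]
      exact ⟨fun h => ⟨h, T.proj.map_source h.2⟩, fun h => h.1⟩

end LinSch

theorem mainTheorem4 :
    LinSch.UniformlySemiNormalized LinSch.linGroup ∧
    (∀ (V V' : LinSch.Potential) (φ : LinSch.LocalTransf), LinSch.Admissible V V' φ →
      ∀ z ∈ φ.source, ∃ (U : Set LinSch.Space) (hU : IsOpen U), z ∈ U ∧ U ⊆ φ.source ∧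
        LinSch.Conjugates (φ.restrOpen U hU) (LinSch.linGroup V) (LinSch.linGroup V') ∧
        ∃ ν ∈ LinSch.linGroup V, ∃ T ∈ LinSch.equivGroup, T.Sends V V' ∧
          φ.restrOpen U hU ≈ ν.trans T.proj) ∧
    (∀ (V V' : LinSch.Potential) (φ : LinSch.LocalTransf), LinSch.Admissible V V' φ →
      LinSch.FibreConvex φ.source → LinSch.FibreConvex φ.target →
        LinSch.Conjugates φ (LinSch.linGroup V) (LinSch.linGroup V') ∧
        ∃ ν ∈ LinSch.linGroup V, ∃ T ∈ LinSch.equivGroup, T.Sends V V' ∧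
          φ ≈ ν.trans T.proj) := by
  refine ⟨LinSch.linGroup_uniformlySemiNormalized, ?_, ?_⟩
  · intro V V' φ hφ z hz
    obtain ⟨U, hU, hzU, hUs, hc, b, b', H, K, σ, hd⟩ := hφ.exists_local hz
    obtain ⟨ν, hν, T, hT, hTV, heq, -⟩ := (hφ.restrOpen hU).exists_factorization hd hc
    exact ⟨U, hU, hzU, hUs, (hφ.restrOpen hU).conjugates hd, ν, hν, T, hT, hTV, heq⟩
  · intro V V' φ hφ hc hc'
    obtain ⟨b, b', H, K, σ, hd⟩ := hφ.exists_global hc hc'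
    obtain ⟨ν, hν, T, hT, hTV, heq, -⟩ := hφ.exists_factorization hd hc
    exact ⟨hφ.conjugates hd, ν, hν, T, hT, hTV, heq⟩
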